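/- Let $\mu$ be an infinite cardinal, $\theta_1=\mu^+<\theta_2<\lambda$ cardinals with $\theta_2$ regular. Conventions. Let $\tau^*_2=\{<,P_0,P_1\}$ with $<$ binary and $P_0,P_1$ unary, and let $K^{\rm lin}_{\tau^*_2}$ be the class of $\tau^*_2$-structures in which $<$ is a linear order and $P_0,P_1$ partition the universe. For a cardinal $\kappa$ and an ordinal $\zeta$ let $I^{\rm lin}_{\kappa,\zeta}=(\zeta,<,P_0,P_1)$ with $P_0=\{\alpha<\zeta:\mathrm{cf}(\alpha)<\kappa\}$ and $P_1=\{\alpha<\zeta:\mathrm{cf}(\alpha)\ge\kappa\}$. A template $\Psi$ consists of a vocabulary $\tau(\Psi)\supseteq\tau^*_2$ and a function sending quantifier-free $n$-types in $\tau^*_2$ to quantifier-free $n$-types in $\tau(\Psi)$, for each $n<\omega$. For $J\in K^{\rm lin}_{\tau^*_2}$, $\mathrm{EM}(J,\Psi)$ is the $\tau(\Psi)$-structure, unique up to isomorphism if it exists, generated by pairwise distinct elements $a_t$ $(t\in J)$ such that the quantifier-free type of $\langle a_{t_0},\dots,a_{t_{n-1}}\rangle$ is the $\Psi$-image of the quantifier-free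 type of $\langle t_0,\dots,t_{n-1}\rangle$ in $J$, for all $t_0,\dots,t_{n-1}\in J$; $\mathrm{EM}_{\tau}(J,\Psi)$ is its reduct to $\tau$, and for $S\subseteq J$, $\mathrm{EM}(S,\Psi)$ is the substructure generated by $\{a_t:t\in S\}$. We write $\Psi\in\Upsilon^{\rm lin}_{\aleph_0}[2]$ if $\tau(\Psi)$ is countable and for every $J\in K^{\rm lin}_{\tau^*_2}$, $\mathrm{EM}(J,\Psi)$ exists, $\mathrm{EM}_{\tau^*_2}(J,\Psi)\in K^{\rm lin}_{\tau^*_2}$, $s<t$ implies $a_s<a_t$, and $t\in P_\ell$ implies $a_t\in P_\ell$. Products of ordinals are ordinal products, so that $\lambda\times\theta$ has cofinality $\theta$ for regular $\theta$. Claim. There is a linear order $I$ of cardinality $\lambda$ with the following properties. (1) The equivalence relation on ${}^{\mu}I$ given by $\eta_1\mathrel{\mathcal E}\eta_2$ iff some automorphism of $I$ maps $\eta_1$ to $\eta_2$ has at most $2^\mu$ classes. (2) If $I'\subseteq I$, $|I'|<\theta_2$ and $n<\omega$, then the equivalence relation on ${}^nI$ given by $\bar s\mathrel{\mathcal E}\bar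 t$ iff some automorphism of $I$ over $I'$ (i.e. fixing $I'$ pointwise) maps $\bar s$ to $\bar t$ has at most $\mu+|I'|$ classes. (3) There is $\Psi\in\Upsilon^{\rm lin}_{\aleph_0}[2]$ such that $I\cong\mathrm{EM}_{\{<\}}(I^{\rm lin}_{\kappa,\lambda\times\theta_2},\Psi)$ for $\kappa=\theta_2$, and also for $\kappa=\theta_1$. (4) If $I^*_0\subseteq I$ and $|I^*_0|<\theta_2$, then there is $I^*_1\subseteq I$ with $|I^*_1|\le\mu^++|I^*_0|$ such that for every $J\subseteq I$ with $|J|\le\mu$ some automorphism of $I$ over $I^*_0$ maps $J$ into $I^*_1$. (5) Moreover, for the $\Psi$ of (3): let $\kappa\in\{\mu,\theta_1,\theta_2\}$, $\theta\in\{\theta_1,\theta_2\}$ and $I^*=I^{\rm lin}_{\kappa,\lambda\times\theta}$. If $I^*_1,I^*_2\subseteq I^*$ have cardinality $\le\mu$ and $h$ is an isomorphism from $I^*_1$ onto $I^*_2$ (as substructures of $I^*$), then there is an automorphism of the linear order $\mathrm{EM}_{\{<\}}(I^*,\Psi)$ that extends the natural isomorphism $a_t\mapsto a_{h(t)}$ from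 $\mathrm{EM}(I^*_1,\Psi)$ onto $\mathrm{EM}(I^*_2,\Psi)$. -/

import Mathlib

open Cardinal FirstOrder

universe u v

namespace HomLin

/-! ### Orbits under automorphisms of a linear order -/

/-- For a linear order `I`, a set `A ⊆ I` and an index set `ι`: two `ι`-indexed sequences of elements
of `I` are equivalent when some automorphism of `I` fixing `A` pointwise maps one to the other. -/
def autSetoid {I : Type u} [LinearOrder I] (A : Set I) (ι : Type v) : Setoid (ι → I) where
  r s t := ∃ h : I ≃o I, (∀ x ∈ A, h x = x) ∧ ∀ i, h (s i) = t i
  iseqv :=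
    { refl := fun _ => ⟨OrderIso.refl I, fun _ _ => rfl, fun _ => rfl⟩
      symm := by
        rintro s t ⟨h, hA, hst⟩
        refine ⟨h.symm, fun x hx => ?_, fun i => ?_⟩
        · rw [OrderIso.symm_apply_eq, hA x hx]
        · rw [OrderIso.symm_apply_eq, hst i]
      trans := by
        rintro r s t ⟨h, hA, hrs⟩ ⟨k, kA, kst⟩
        refine ⟨h.trans k, fun x hx => ?_, fun i => ?_⟩
        · rw [OrderIso.trans_apply, hA x hx, kA x hx]
        · rw [OrderIso.trans_apply, hrs i, kst i] }

/-! ### The vocabulary `{<, P₀, P₁}` and its class of expanded linear orders -/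

/-- The predicates `<` (binary), `P₀` and `P₁` (unary). -/
inductive TauRel : ℕ → Type
  | lt : TauRel 2
  | P0 : TauRel 1
  | P1 : TauRel 1

/-- The relational vocabulary `{<, P₀, P₁}`. -/
def tau : FirstOrder.Language.{0, 0} := ⟨fun _ => Empty, TauRel⟩

/-- `x < y` in a `{<, P₀, P₁}`-structure. -/
def tauLT {M : Type u} [tau.Structure M] (x y : M) : Prop :=
  FirstOrder.Language.Structure.RelMap (L := tau) TauRel.lt ![x, y]

/-- `P₀ x` in a `{<, P₀, P₁}`-structure. -/
def tauP0 {M : Type u} [tau.Structure M] (x : M) : Prop :=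
  FirstOrder.Language.Structure.RelMap (L := tau) TauRel.P0 ![x]

/-- `P₁ x` in a `{<, P₀, P₁}`-structure. -/
def tauP1 {M : Type u} [tau.Structure M] (x : M) : Prop :=
  FirstOrder.Language.Structure.RelMap (L := tau) TauRel.P1 ![x]

/-- The class of expanded linear orders: `<` is a (strict) linear order and `P₀`, `P₁` partition the
universe. -/
structure IsKlin (M : Type u) [tau.Structure M] : Prop where
  irrefl : ∀ x : M, ¬ tauLT x x
  trans : ∀ x y z : M, tauLT x y → tauLT y z → tauLT x z
  total : ∀ x y : M, tauLT x y ∨ x = y ∨ tauLT y x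
  cover : ∀ x : M, tauP0 x ∨ tauP1 x
  disjoint : ∀ x : M, ¬ (tauP0 x ∧ tauP1 x)

/-- The universe of `I^lin_{κ,ζ}`: the set of ordinals `< ζ`. -/
def Ilin (_κ : Cardinal.{u}) (ζ : Ordinal.{u}) : Type u := ζ.ToType

/-- The ordinal `< ζ` that an element of `I^lin_{κ,ζ}` is. -/
noncomputable def Ilin.ord {κ : Cardinal.{u}} {ζ : Ordinal.{u}} (x : Ilin κ ζ) : Ordinal.{u} :=
  (Ordinal.ToType.toOrd (o := ζ) x : Ordinal.{u})

/-- `I^lin_{κ,ζ} = (ζ, <, P₀, P₁)` with `P₀ = {α < ζ : cf α < κ}` and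
`P₁ = {α < ζ : cf α ≥ κ}`. -/
noncomputable instance Ilin.structure (κ : Cardinal.{u}) (ζ : Ordinal.{u}) :
    tau.Structure (Ilin κ ζ) where
  funMap := fun f _ => Empty.elim f
  RelMap := fun r => match r with
    | TauRel.lt => fun x => (x 0).ord < (x 1).ord
    | TauRel.P0 => fun x => (x 0).ord.cof < κ
    | TauRel.P1 => fun x => κ ≤ (x 0).ord.cof

/-! ### Templates and Ehrenfeucht-Mostowski models -/

/-- The quantifier-free type of a finite tuple in a structure. -/
def qfType (L : FirstOrder.Language.{0, 0}) {M : Type u} [L.Structure M] {n : ℕ} (x : Fin n → M) :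
    Set (L.Formula (Fin n)) :=
  {φ | FirstOrder.Language.BoundedFormula.IsQF φ ∧ φ.Realize x}

/-- The data of a template `Ψ`: a vocabulary `τ(Ψ)` with an interpretation of `<, P₀, P₁` by symbols
of `τ(Ψ)`, and a function from quantifier-free types in `{<, P₀, P₁}` to quantifier-free types in
`τ(Ψ)`. -/
structure Template where
  L : FirstOrder.Language.{0, 0}
  emb : tau →ᴸ L
  typ : ∀ n : ℕ, Set (tau.Formula (Fin n)) → Set (L.Formula (Fin n))

/-- `M` is (a copy of) `EM(I, Ψ)` with skeleton `a`: the skeleton is one-to-one and generates `M`, and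
the quantifier-free type of `(a (t 0), …, a (t (n-1)))` in `M` is the one which `Ψ` assigns to the
quantifier-free type of `(t 0, …, t (n-1))` in `I`. -/
structure IsEM (Ψ : Template) {I M : Type u} [tau.Structure I] [Ψ.L.Structure M] (a : I → M) :
    Prop where
  injective : Function.Injective a
  generates : FirstOrder.Language.Substructure.closure Ψ.L (Set.range a) = ⊤
  qfType_eq : ∀ (n : ℕ) (t : Fin n → I),
    qfType Ψ.L (fun i => a (t i)) = Ψ.typ n (qfType tau t)

/-- The order relation of the reduct to `{<}` of a `τ(Ψ)`-structure. -/
def emLT (Ψ : Template) {M : Type u} [Ψ.L.Structure M] (x y : M) : Prop :=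
  @tauLT M (Ψ.emb.reduct M) x y

/-- `Ψ ∈ Υ^lin_{ℵ₀}[2]`: the vocabulary is countable and contains `<, P₀, P₁`; `Ψ` is proper for the
class of expanded linear orders, that is, `EM(I, Ψ)` exists for every `I` in the class; and its reduct
to `{<, P₀, P₁}` is again in the class and extends `I`. -/
structure IsUpsilonLin2 (Ψ : Template) : Prop where
  countable : Ψ.L.card ≤ ℵ₀
  emb_injective : Ψ.emb.Injective
  proper : ∀ (I : Type u) [tau.Structure I], IsKlin I →
    ∃ (M : Type u) (_ : Ψ.L.Structure M) (a : I → M), IsEM Ψ a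
  klin : ∀ (I : Type u) [tau.Structure I], IsKlin I →
    ∀ (M : Type u) [Ψ.L.Structure M] (a : I → M), IsEM Ψ a →
      @IsKlin M (Ψ.emb.reduct M) ∧
      (∀ s t : I, tauLT s t → emLT Ψ (a s) (a t)) ∧
      (∀ t : I, tauP0 t → @tauP0 M (Ψ.emb.reduct M) (a t)) ∧
      (∀ t : I, tauP1 t → @tauP1 M (Ψ.emb.reduct M) (a t))

/-- The linear order `I` is (isomorphic to) `EM_{<}(J, Ψ)`. -/
def IsEMlt (Ψ : Template) (J I : Type u) [tau.Structure J] [LinearOrder I] : Prop :=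
  ∃ (M : Type u) (_ : Ψ.L.Structure M) (a : J → M), IsEM Ψ a ∧
    ∃ e : I ≃ M, ∀ x y : I, x < y ↔ emLT Ψ (e x) (e y)

/-- The submodel `EM(S, Ψ)` of `EM(J, Ψ)` for `S ⊆ J`: the part generated by `{a t : t ∈ S}`. -/
def emSub (Ψ : Template) {J M : Type u} [tau.Structure J] [Ψ.L.Structure M] (a : J → M)
    (S : tau.Substructure J) : Ψ.L.Substructure M :=
  FirstOrder.Language.Substructure.closure Ψ.L (a '' (S : Set J))

/-- For any isomorphism `h` between two substructures of `J` of cardinality `≤ μ`, the natural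
isomorphism from `EM(S₁, Ψ)` onto `EM(S₂, Ψ)` which it induces (`a t ↦ a (h t)`) exists and extends to
an automorphism of the linear order `EM_{<}(J, Ψ)`. As the vocabulary of `J` is relational, its
substructures are the same as its subsets. -/
def ExtendsToAut (Ψ : Template) (J : Type u) [tau.Structure J] (μ : Cardinal.{u}) : Prop :=
  ∀ (M : Type u) [Ψ.L.Structure M] (a : J → M), IsEM Ψ a →
    ∀ S₁ S₂ : tau.Substructure J, #S₁ ≤ μ → #S₂ ≤ μ → ∀ h : S₁ ≃[tau] S₂,
      ∃ hcheck : emSub Ψ a S₁ ≃[Ψ.L] emSub Ψ a S₂,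
        (∀ t : S₁, (hcheck ⟨a t, FirstOrder.Language.Substructure.subset_closure ⟨t, t.2, rfl⟩⟩ : M)
            = a (h t)) ∧
        ∃ g : M ≃ M, (∀ x y : M, emLT Ψ x y ↔ emLT Ψ (g x) (g y)) ∧
          ∀ x : emSub Ψ a S₁, g x = (hcheck x : M)

end HomLin

/-! Let `J` be the ordinal `λ·θ₂` and let `I` be the set of finite signed words over `J`, ordered
lexicographically, where the end of a word lies above the negative letters (taken in reverse order)
and below the positive ones. With the empty word, sign change and concatenation as operations, `I`
is generated by the one-letter words. Its order does not look at `P₀` and `P₁`, so the same `I`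
serves for every `κ`.

Everything rests on one homogeneity statement, `exists_orderIso_map`: two order-isomorphic bounded
families `p`, `q` in `J` are conjugate under an automorphism of `I`, simultaneously for all words
over them. Boundedness is cheap, because `J` has cofinality `θ₂`. Moreover `J` is additively
indecomposable, so each of its final segments `[b, ·)` is a copy of `J`. With Lindenbaum's theorem
this makes `I` self-similar: `J` copies of `I` in a row, the words with a positive first letter
above `b`, and two consecutive copies of `I` are again copies of `I`.

To carry `p` to `q`, fix a common strict bound `b`. In the cone of words that begin with `p k`, only
the core has to be moved rigidly: the continuations that are empty or whose first index is at most
`b`. The rest of each cone is room for manoeuvre. The gap at each cut of `p` is therefore a copy of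
`I`, whatever happens in `J` itself, where `p k` and `p k'` may be adjacent while `q k` and `q k'`
are not, or `p` may be continuous at a limit where `q` is not. So the gaps of `p` can be matched
with those of `q`. Sign change transports this to negative letters, and recursion along the word to
later letters.

The orbit counts then only concern order patterns of letters. A `μ`-sequence has at most `2^μ`
patterns. Over a small set `S` of letters, well-ordering helps: a cut of `S` is named by its least
upper element, so there are at most `|S|+1` cuts. To absorb `μ` many letters over `S`, collapse
those in each cut to an initial segment of that cut, which involves at most `μ⁺` indices per cut.
For (5), an arbitrary EM model is replaced by the isomorphic structure of words
(`exists_equiv_word`). -/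

namespace HomLin

/-! ### Signed words and their order -/

/-- The order of signed letters induced by a relation `r`: negative letters, in reverse order, come
before positive letters. -/
def letterLT {J : Type*} (r : J → J → Prop) : Bool × J → Bool × J → Prop
  | (false, i), (false, j) => r j i
  | (false, _), (true, _) => True
  | (true, _), (false, _) => False
  | (true, i), (true, j) => r i j

/-- The lexicographic order of signed words, where the end of a word lies between the negative and the
positive letters. -/
def wordLT {J : Type*} (r : J → J → Prop) : List (Bool × J) → List (Bool × J) → Prop
  | [], [] => False
  | [], b :: _ => b.1 = true
  | a :: _, [] => a.1 = false
  | a :: x, b :: y => letterLT r a b ∨ (a = b ∧ wordLT r x y)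

theorem letterLT_irrefl {J : Type*} {r : J → J → Prop} (h : ∀ i, ¬ r i i) (a : Bool × J) :
    ¬ letterLT r a a := by
  obtain ⟨_ | _, i⟩ := a <;> exact h i

theorem letterLT_trans {J : Type*} {r : J → J → Prop} (h : ∀ i j k, r i j → r j k → r i k)
    (a b c : Bool × J) : letterLT r a b → letterLT r b c → letterLT r a c := by
  obtain ⟨_ | _, i⟩ := a <;> obtain ⟨_ | _, j⟩ := b <;> obtain ⟨_ | _, k⟩ := c <;>
    simp only [letterLT, true_imp_iff, false_imp_iff, imp_true_iff]
  · exact fun h₁ h₂ => h _ _ _ h₂ h₁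
  · exact h i j k

theorem letterLT_total {J : Type*} {r : J → J → Prop} (h : ∀ i j, r i j ∨ i = j ∨ r j i)
    (a b : Bool × J) : letterLT r a b ∨ a = b ∨ letterLT r b a := by
  obtain ⟨_ | _, i⟩ := a <;> obtain ⟨_ | _, j⟩ := b <;> simp [letterLT]
  · have := h i j; tauto
  · exact h i j

theorem letterLT_of_sign {J : Type*} {r : J → J → Prop} {a b : Bool × J} (ha : a.1 = false)
    (hb : b.1 = true) : letterLT r a b := by
  obtain ⟨_ | _, i⟩ := a <;> obtain ⟨_ | _, j⟩ := b <;> simp_all [letterLT]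

theorem letterLT_pos {J : Type*} {r : J → J → Prop} {a b : Bool × J} (h : letterLT r a b)
    (ha : a.1 = true) : b.1 = true := by
  obtain ⟨_ | _, i⟩ := a <;> obtain ⟨_ | _, j⟩ := b <;> simp_all [letterLT]

theorem letterLT_neg {J : Type*} {r : J → J → Prop} {a b : Bool × J} (h : letterLT r a b)
    (hb : b.1 = false) : a.1 = false := by
  obtain ⟨_ | _, i⟩ := a <;> obtain ⟨_ | _, j⟩ := b <;> simp_all [letterLT]

theorem wordLT_irrefl {J : Type*} {r : J → J → Prop} (h : ∀ i, ¬ r i i) (x : List (Bool × J)) :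
    ¬ wordLT r x x := by
  induction x with
  | nil => simp [wordLT]
  | cons a x ih => simp [wordLT, ih, letterLT_irrefl h]

theorem wordLT_trans {J : Type*} {r : J → J → Prop} (h : ∀ i j k, r i j → r j k → r i k)
    (x y z : List (Bool × J)) : wordLT r x y → wordLT r y z → wordLT r x z := by
  induction x generalizing y z with
  | nil =>
    rcases y with _ | ⟨b, y⟩ <;> rcases z with _ | ⟨c, z⟩ <;> simp only [wordLT] <;> intro h₁ h₂
    · exact h₂
    · exact h₁.elim
    · exact absurd (h₁.symm.trans h₂) (by simp)
    · rcases h₂ with h₂ | ⟨h₂, -⟩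
      · exact letterLT_pos h₂ h₁
      · exact h₂ ▸ h₁
  | cons a x ih =>
    rcases y with _ | ⟨b, y⟩ <;> rcases z with _ | ⟨c, z⟩ <;> simp only [wordLT] <;> intro h₁ h₂
    · exact h₂.elim
    · exact Or.inl (letterLT_of_sign h₁ h₂)
    · rcases h₁ with h₁ | ⟨rfl, -⟩
      · exact letterLT_neg h₁ h₂
      · exact h₂
    · rcases h₁ with h₁ | ⟨rfl, h₁⟩ <;> rcases h₂ with h₂ | ⟨rfl, h₂⟩
      · exact Or.inl (letterLT_trans h _ _ _ h₁ h₂)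
      · exact Or.inl h₁
      · exact Or.inl h₂
      · exact Or.inr ⟨rfl, ih _ _ h₁ h₂⟩

theorem wordLT_total {J : Type*} {r : J → J → Prop} (h : ∀ i j, r i j ∨ i = j ∨ r j i)
    (x y : List (Bool × J)) : wordLT r x y ∨ x = y ∨ wordLT r y x := by
  induction x generalizing y with
  | nil =>
    rcases y with _ | ⟨⟨_ | _, b⟩, y⟩ <;> simp [wordLT]
  | cons a x ih =>
    rcases y with _ | ⟨b, y⟩
    · obtain ⟨_ | _, i⟩ := a <;> simp [wordLT]
    · have h₁ := letterLT_total h a b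
      have h₂ := ih y
      simp only [wordLT, List.cons.injEq]
      rcases h₁ with h₁ | rfl | h₁
      · exact Or.inl (Or.inl h₁)
      · rcases h₂ with h₂ | rfl | h₂
        · exact Or.inl (Or.inr ⟨rfl, h₂⟩)
        · exact Or.inr (Or.inl ⟨rfl, rfl⟩)
        · exact Or.inr (Or.inr (Or.inr ⟨rfl, h₂⟩))
      · exact Or.inr (Or.inr (Or.inl h₁))

/-- Changing all signs in a word. -/
def wordNeg {J : Type*} (x : List (Bool × J)) : List (Bool × J) := x.map fun a => (!a.1, a.2)

@[simp] theorem wordNeg_wordNeg {J : Type*} (x : List (Bool × J)) : wordNeg (wordNeg x) = x := by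
  simp [wordNeg, Function.comp_def]

theorem letterLT_neg_iff {J : Type*} {r : J → J → Prop} (a b : Bool × J) :
    letterLT r (!a.1, a.2) (!b.1, b.2) ↔ letterLT r b a := by
  obtain ⟨_ | _, i⟩ := a <;> obtain ⟨_ | _, j⟩ := b <;> simp [letterLT]

theorem wordLT_wordNeg {J : Type*} {r : J → J → Prop} (x y : List (Bool × J)) :
    wordLT r (wordNeg x) (wordNeg y) ↔ wordLT r y x := by
  induction x generalizing y with
  | nil => rcases y with _ | ⟨b, y⟩ <;> simp [wordLT, wordNeg]
  | cons a x ih =>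
    rcases y with _ | ⟨b, y⟩
    · simp [wordLT, wordNeg]
    · have := ih y
      simp only [wordNeg] at this
      simp only [wordNeg, List.map_cons, wordLT, letterLT_neg_iff, this]
      simp only [Prod.ext_iff, Bool.not_inj_iff]
      tauto

/-- The signed words over `J`. -/
def Word (J : Type u) : Type u := List (Bool × J)

/-- The word with first letter `a` followed by `x`. -/
def Word.cons {J : Type u} (a : Bool × J) (x : Word J) : Word J := List.cons a x

/-- The empty word. -/
def Word.nil {J : Type u} : Word J := []

/-- Renaming the letters of a word. -/
def Word.map {K : Type v} {J : Type u} (p : K → J) (w : Word K) : Word J :=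
  List.map (fun a => (a.1, p a.2)) w

@[simp] theorem Word.map_cons {K : Type v} {J : Type u} (p : K → J) (a : Bool × K) (w : Word K) :
    Word.map p (Word.cons a w) = Word.cons (a.1, p a.2) (Word.map p w) := rfl

theorem Word.map_map {K : Type*} {J : Type*} {J' : Type*} (p : K → J) (q : J → J') (w : Word K) :
    (w.map p).map q = w.map (q ∘ p) := by
  exact List.map_map

@[elab_as_elim]
theorem Word.ind {J : Type u} {P : Word J → Prop} (nil : P Word.nil)
    (cons : ∀ a x, P x → P (Word.cons a x)) (w : Word J) : P w :=
  List.rec nil cons w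

theorem Word.cons_inj {J : Type u} {a b : Bool × J} {x y : Word J} :
    Word.cons a x = Word.cons b y ↔ a = b ∧ x = y := List.cons.injEq _ _ _ _ ▸ Iff.rfl

theorem Word.cons_ne_nil {J : Type u} (a : Bool × J) (x : Word J) : Word.cons a x ≠ Word.nil :=
  List.cons_ne_nil _ _

noncomputable instance {J : Type u} [LinearOrder J] : LinearOrder (Word J) :=
  haveI : IsStrictTotalOrder (Word J) (wordLT (· < ·)) :=
    { irrefl := wordLT_irrefl lt_irrefl
      trans := wordLT_trans fun _ _ _ => lt_trans
      trichotomous := fun a b h₁ h₂ => by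
        rcases wordLT_total lt_trichotomy a b with h | h | h
        · exact (h₁ h).elim
        · exact h
        · exact (h₂ h).elim }
  @linearOrderOfSTO (Word J) (wordLT (· < ·)) _ (Classical.decRel _)

section
variable {J : Type u} [LinearOrder J]

@[simp] theorem Word.cons_lt_cons {a b : Bool × J} {x y : Word J} :
    Word.cons a x < Word.cons b y ↔ letterLT (· < ·) a b ∨ (a = b ∧ x < y) := Iff.rfl

@[simp] theorem Word.cons_lt_nil {a : Bool × J} {x : Word J} :
    Word.cons a x < Word.nil ↔ a.1 = false := Iff.rfl

@[simp] theorem Word.nil_lt_cons {a : Bool × J} {x : Word J} :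
    Word.nil < Word.cons a x ↔ a.1 = true := Iff.rfl

/-- Changing all signs reverses the order. -/
def Word.neg : Word J ≃o (Word J)ᵒᵈ where
  toFun x := OrderDual.toDual (wordNeg x)
  invFun x := wordNeg (OrderDual.ofDual x)
  left_inv := wordNeg_wordNeg
  right_inv := fun x => wordNeg_wordNeg (OrderDual.ofDual x)
  map_rel_iff' := by
    intro x y
    rw [← not_lt, ← not_lt]
    exact not_congr (wordLT_wordNeg (r := (· < ·)) x y)

/-! ### Gluing and cutting linear orders -/

theorem exists_least [WellFoundedLT J] {P : J → Prop} (h : ∃ j, P j) :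
    ∃ m, P m ∧ ∀ j, P j → m ≤ j := by
  obtain ⟨m, hm, hmin⟩ := WellFounded.has_min (wellFounded_lt (α := J)) {j | P j} h
  exact ⟨m, hm, fun j hj => not_lt.1 (hmin j hj)⟩
end

/-- Lindenbaum's theorem: two linear orders are isomorphic if the first is isomorphic to an initial
segment of the second and the second to a final segment of the first. -/
theorem lindenbaum {X Y : Type*} [LinearOrder X] [LinearOrder Y] (f : X → Y) (g : Y → X)
    (hf : StrictMono f) (hg : StrictMono g) (hf' : ∀ x y, y ≤ f x → ∃ x', f x' = y)
    (hg' : ∀ y x, g y ≤ x → ∃ y', g y' = x) : Nonempty (X ≃o Y) := by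
  classical
  -- The Cantor–Bernstein set: everything reached from outside the range of `g` by iterating `g ∘
  -- f`. Since the ranges are an initial and a final segment, `C` is an initial segment, so using
  -- `f` on `C` and the inverse of `g` elsewhere is monotone.
  let C : Set X := {x | ∃ (n : ℕ) (z : X), (∀ y, g y ≠ z) ∧ (fun t => g (f t))^[n] z = x}
  have hC : ∀ x, x ∉ C → ∃ y, g y = x := by
    intro x hx
    by_contra h
    exact hx ⟨0, x, not_exists.1 h, rfl⟩
  have hCs : ∀ x ∈ C, g (f x) ∈ C := by
    rintro x ⟨n, z, hz, rfl⟩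
    exact ⟨n + 1, z, hz, Function.iterate_succ_apply' _ _ _⟩
  have hlow : ∀ x ∈ C, ∀ y ≤ x, y ∈ C := by
    rintro x ⟨n, z, hz, rfl⟩
    induction n with
    | zero =>
      intro y hy
      by_contra hyC
      obtain ⟨y', rfl⟩ := hC y hyC
      obtain ⟨z', hz'⟩ := hg' _ _ hy
      exact hz z' hz'
    | succ n ih =>
      intro y hy
      by_contra hyC
      obtain ⟨y', rfl⟩ := hC y hyC
      rw [Function.iterate_succ_apply'] at hy
      obtain ⟨x'', rfl⟩ := hf' _ _ (hg.le_iff_le.1 hy)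
      exact hyC (hCs _ (ih _ (hf.le_iff_le.1 (hg.le_iff_le.1 hy))))
  rcases isEmpty_or_nonempty Y with hY | hY
  · have : IsEmpty X := ⟨fun x => hY.elim (f x)⟩
    exact ⟨StrictMono.orderIsoOfSurjective f hf fun y => hY.elim y⟩
  choose! k hk using hC
  let F : X → Y := fun x => if x ∈ C then f x else k x
  refine ⟨StrictMono.orderIsoOfSurjective F ?_ ?_⟩
  · intro x y hxy
    by_cases hy : y ∈ C
    · have hx := hlow y hy x hxy.le
      simpa [F, hx, hy] using hf hxy
    · by_cases hx : x ∈ C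
      · simp only [F, hx, hy, if_true, if_false]
        rw [← hg.lt_iff_lt, hk y hy]
        exact not_le.1 fun h => hy (hlow _ (hCs x hx) _ h)
      · simp only [F, hx, hy, if_false]
        rw [← hg.lt_iff_lt, hk y hy, hk x hx]
        exact hxy
  · intro y
    by_cases hy : g y ∈ C
    · obtain ⟨n, z, hz, hzy⟩ := hy
      cases n with
      | zero => exact (hz y hzy.symm).elim
      | succ n =>
        rw [Function.iterate_succ_apply'] at hzy
        refine ⟨(fun t => g (f t))^[n] z, ?_⟩
        have : (fun t => g (f t))^[n] z ∈ C := ⟨n, z, hz, rfl⟩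
        simp only [F, this, if_true]
        exact hg.injective hzy
    · exact ⟨g y, by simp only [F, hy, if_false]; exact hg.injective (hk _ hy)⟩

/-- Isomorphisms between the fibres of two monotone maps glue. -/
theorem exists_orderIso_of_fiber {X Y Z : Type*} [LinearOrder X] [LinearOrder Y] [PartialOrder Z]
    {f : X → Z} {g : Y → Z} (hf : Monotone f) (hg : Monotone g) (R : X → Y → Prop)
    (h : ∀ z, ∃ e : {x | f x = z} ≃o {y | g y = z}, ∀ x : {x | f x = z}, R x (e x)) :
    ∃ E : X ≃o Y, ∀ x, R x (E x) := by
  choose e he using h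
  have hge : ∀ z (x : {x | f x = z}), g (e z x) = z := fun z x => (e z x).2
  let E : X → Y := fun x => e (f x) ⟨x, rfl⟩
  have hE : ∀ z (x : {x | f x = z}), E x = e z x := by
    rintro z ⟨x, rfl⟩
    rfl
  refine ⟨StrictMono.orderIsoOfSurjective E ?_ ?_, fun x => he (f x) ⟨x, rfl⟩⟩
  · intro x y hxy
    rcases (hf hxy.le).lt_or_eq with h | h
    · rw [← hge (f x) ⟨x, rfl⟩, ← hge (f y) ⟨y, rfl⟩] at h
      exact not_le.1 fun h' => (hg h').not_gt h
    · have h₁ := hE (f y) ⟨x, h⟩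
      have h₂ := hE (f y) ⟨y, rfl⟩
      simp only at h₁ h₂
      rw [h₁, h₂]
      exact (e (f y)).strictMono hxy
  · intro y
    refine ⟨(e (g y)).symm ⟨y, rfl⟩, ?_⟩
    rw [hE (g y)]
    simp

section
variable {J : Type u} [LinearOrder J]

/-! ### Convex sets of words that are isomorphic to the set of all words -/

/-- Prefixing a positive letter, as a function on the lexicographic product. -/
def Word.consPos (x : J ×ₗ Word J) : Word J := Word.cons (true, (ofLex x).1) (ofLex x).2

theorem Word.consPos_strictMono : StrictMono (Word.consPos (J := J)) := by
  intro x y h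
  rw [Prod.Lex.lt_iff] at h
  simpa [consPos, letterLT] using h

theorem Word.exists_consPos {i : J} {x y : Word J} (h : Word.cons (true, i) x ≤ y) :
    ∃ j z, i ≤ j ∧ y = Word.cons (true, j) z := by
  induction y using Word.ind with
  | nil => exact absurd h (by simp)
  | cons a y =>
    obtain ⟨s, j⟩ := a
    cases s with
    | false => exact absurd h (not_le.2 (by simp [letterLT]))
    | true =>
      refine ⟨j, y, not_lt.1 fun hj => absurd h (not_le.2 (by simp [letterLT, hj])), rfl⟩

theorem exists_consPos_eq {y : J ×ₗ Word J} {x : Word J} (h : Word.consPos y ≤ x) :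
    ∃ y', Word.consPos y' = x := by
  obtain ⟨j, z, -, rfl⟩ := Word.exists_consPos h
  exact ⟨toLex (j, z), rfl⟩

/-- The words whose first letter is a positive letter above `b`. -/
def highWords (b : J) : Set (Word J) := {x | ∃ i z, b < i ∧ x = Word.cons (true, i) z}

/-- The words whose first letter is a negative letter with index above `b`. -/
def lowWords (b : J) : Set (Word J) := {x | ∃ i z, b < i ∧ x = Word.cons (false, i) z}

/-- The words whose first letter, if any, has an index at most `b`. -/
def midWords (b : J) : Set (Word J) := {x | ∀ i s z, x = Word.cons (s, i) z → i ≤ b}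

theorem nil_mem_midWords (b : J) : Word.nil ∈ midWords b := fun _ _ _ h =>
  (Word.cons_ne_nil _ _ h.symm).elim

theorem cons_mem_midWords {b : J} {a : Bool × J} {x : Word J} :
    Word.cons a x ∈ midWords b ↔ a.2 ≤ b := by
  constructor
  · intro h
    exact h a.2 a.1 x rfl
  · intro h i s z hz
    obtain ⟨rfl, -⟩ := Word.cons_inj.1 hz
    exact h

theorem cons_mem_highWords {b : J} {a : Bool × J} {x : Word J} :
    Word.cons a x ∈ highWords b ↔ a.1 = true ∧ b < a.2 := by
  constructor
  · rintro ⟨i, z, h, hz⟩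
    obtain ⟨rfl, -⟩ := Word.cons_inj.1 hz
    exact ⟨rfl, h⟩
  · rintro ⟨h₁, h₂⟩
    exact ⟨a.2, x, h₂, by rw [← h₁]⟩

theorem cons_mem_lowWords {b : J} {a : Bool × J} {x : Word J} :
    Word.cons a x ∈ lowWords b ↔ a.1 = false ∧ b < a.2 := by
  constructor
  · rintro ⟨i, z, h, hz⟩
    obtain ⟨rfl, -⟩ := Word.cons_inj.1 hz
    exact ⟨rfl, h⟩
  · rintro ⟨h₁, h₂⟩
    exact ⟨a.2, x, h₂, by rw [← h₁]⟩

theorem nil_not_mem_highWords (b : J) : Word.nil ∉ highWords b := by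
  rintro ⟨i, z, -, h⟩
  exact Word.cons_ne_nil _ _ h.symm

theorem nil_not_mem_lowWords (b : J) : Word.nil ∉ lowWords b := by
  rintro ⟨i, z, -, h⟩
  exact Word.cons_ne_nil _ _ h.symm

theorem mem_highWords_of_le {b : J} {x y : Word J} (hx : x ∈ highWords b) (h : x ≤ y) :
    y ∈ highWords b := by
  obtain ⟨i, z, hi, rfl⟩ := hx
  obtain ⟨j, z', hj, rfl⟩ := Word.exists_consPos h
  exact ⟨j, z', hi.trans_le hj, rfl⟩

theorem neg_mem_highWords {b : J} {x : Word J} :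
    OrderDual.ofDual (Word.neg x) ∈ highWords b ↔ x ∈ lowWords b := by
  induction x using Word.ind with
  | nil => exact iff_of_false (nil_not_mem_highWords b) (nil_not_mem_lowWords b)
  | cons a x =>
    have : OrderDual.ofDual (Word.neg (Word.cons a x)) =
      Word.cons (!a.1, a.2) (OrderDual.ofDual (Word.neg x)) := rfl
    rw [this, cons_mem_highWords, cons_mem_lowWords]
    simp

theorem mem_lowWords_of_le {b : J} {x y : Word J} (hx : x ∈ lowWords b) (h : y ≤ x) :
    y ∈ lowWords b := by
  rw [← neg_mem_highWords] at hx ⊢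
  exact mem_highWords_of_le hx (Word.neg.monotone h)

theorem mem_highWords_of {b : J} {x : Word J} (h₁ : x ∉ midWords b) (h₂ : x ∉ lowWords b) :
    x ∈ highWords b := by
  induction x using Word.ind with
  | nil => exact (h₁ (nil_mem_midWords b)).elim
  | cons a x =>
    rw [cons_mem_midWords] at h₁
    rw [cons_mem_lowWords] at h₂
    rw [cons_mem_highWords]
    rw [not_le] at h₁
    simpa [h₁] using h₂

theorem not_mem_lowWords {b : J} {x : Word J} (h : x ∈ midWords b) : x ∉ lowWords b := by
  induction x using Word.ind with
  | nil => exact nil_not_mem_lowWords b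
  | cons a x =>
    rw [cons_mem_midWords] at h
    rw [cons_mem_lowWords]
    exact fun h' => h.not_gt h'.2

theorem not_mem_highWords {b : J} {x : Word J} (h : x ∈ midWords b) : x ∉ highWords b := by
  induction x using Word.ind with
  | nil => exact nil_not_mem_highWords b
  | cons a x =>
    rw [cons_mem_midWords] at h
    rw [cons_mem_highWords]
    exact fun h' => h.not_gt h'.2

/-! ### Self-similarity of the order of words -/

variable [WellFoundedLT J]

/-- The cone over the least index is an initial segment of the product, and the words with positive
first letter are a final segment of `Word J`. Lindenbaum's theorem applies. -/
theorem nonempty_words_orderIso_prod [Nonempty J] : Nonempty (Word J ≃o J ×ₗ Word J) := by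
  obtain ⟨m, -, hm⟩ := exists_least (J := J) (P := fun _ => True) ⟨Classical.arbitrary J, trivial⟩
  refine lindenbaum (fun x => toLex (m, x)) Word.consPos ?_ Word.consPos_strictMono ?_ ?_
  · intro x y h
    simpa [Prod.Lex.lt_iff] using h
  · intro x y h
    refine ⟨(ofLex y).2, ?_⟩
    rw [Prod.Lex.le_iff] at h
    rcases h with h | h
    · exact absurd h (hm _ trivial).not_gt
    · apply ofLex.injective
      exact Prod.ext h.1.symm rfl
  · exact fun _ _ => exists_consPos_eq

/-- Lindenbaum again: the cone over the least index above `b` is initial in `highWords b`, which is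
itself final in `Word J`. -/
theorem nonempty_highWords_orderIso [NoMaxOrder J] (b : J) :
    Nonempty (highWords b ≃o Word J) := by
  obtain ⟨m, hbm, hm⟩ := exists_least (J := J) (exists_gt b)
  refine (lindenbaum (X := Word J) (fun x => (⟨Word.cons (true, m) x, m, x, hbm, rfl⟩ : highWords b))
    Subtype.val ?_ (Subtype.strictMono_coe _) ?_ ?_).map OrderIso.symm
  · intro x y h
    rw [← Subtype.coe_lt_coe]
    exact Or.inr ⟨rfl, h⟩
  · rintro x ⟨y, i, z, hi, rfl⟩ h
    refine ⟨z, ?_⟩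
    have := hm i hi
    have h' : ¬ m < i := fun h' => absurd h (not_le.2 (by
      rw [← Subtype.coe_lt_coe]; simp [letterLT, h']))
    obtain rfl : m = i := this.antisymm (not_lt.1 h')
    rfl
  · rintro ⟨y, hy⟩ x h
    exact ⟨⟨x, mem_highWords_of_le hy h⟩, rfl⟩

/-- Conjugate the previous isomorphism by sign change. The two reversals of order cancel. -/
theorem nonempty_lowWords_orderIso [NoMaxOrder J] (b : J) : Nonempty (lowWords b ≃o Word J) := by
  obtain ⟨e⟩ := nonempty_highWords_orderIso b
  let f : lowWords b → Word J := fun x =>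
    OrderDual.ofDual (Word.neg (e ⟨OrderDual.ofDual (Word.neg x.1), neg_mem_highWords.2 x.2⟩))
  refine ⟨StrictMono.orderIsoOfSurjective f ?_ ?_⟩
  · intro x y hxy
    exact (Word.neg (J := J)).strictMono (e.strictMono ((Word.neg (J := J)).strictMono hxy))
  · intro y
    obtain ⟨z, hz⟩ := e.surjective (OrderDual.ofDual (Word.neg y))
    have hz' : OrderDual.ofDual (Word.neg (OrderDual.ofDual (Word.neg z.1))) = z.1 :=
      wordNeg_wordNeg z.1
    refine ⟨⟨OrderDual.ofDual (Word.neg z.1), neg_mem_highWords.1 (by rw [hz']; exact z.2)⟩, ?_⟩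
    have : (⟨_, neg_mem_highWords.2 (neg_mem_highWords.1 (hz'.symm ▸ z.2))⟩ : highWords b) = z :=
      Subtype.ext hz'
    simp only [f]
    rw [this, hz]
    exact wordNeg_wordNeg y

/-- A block of cones indexed by the interval `[l, b)`, followed by a copy of the set of all words in
the cone over `b`, is isomorphic to the set of all words. -/
theorem nonempty_block_orderIso (hJ : ∀ b : J, Nonempty (Set.Ici b ≃o J)) {l b : J} (hlb : l ≤ b)
    {V : Set (Word J)} (hV : Nonempty (V ≃o Word J)) :
    Nonempty ({x : J ×ₗ Word J | l ≤ (ofLex x).1 ∧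
      ((ofLex x).1 < b ∨ ((ofLex x).1 = b ∧ (ofLex x).2 ∈ V))} ≃o Word J) := by
  classical
  obtain ⟨e⟩ := hJ l
  obtain ⟨σ⟩ := hV
  have : Nonempty J := ⟨b⟩
  obtain ⟨d⟩ := nonempty_words_orderIso_prod (J := J)
  set D := {x : J ×ₗ Word J | l ≤ (ofLex x).1 ∧
      ((ofLex x).1 < b ∨ ((ofLex x).1 = b ∧ (ofLex x).2 ∈ V))} with hD
  -- An initial segment: `e` lets the indices start at the bottom of `J`, and `σ` enlarges the
  -- truncated last cone to a full one.
  let f : D → J ×ₗ Word J := fun x =>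
    toLex (e ⟨(ofLex x.1).1, x.2.1⟩, if h : (ofLex x.1).2 ∈ V ∧ (ofLex x.1).1 = b
      then σ ⟨(ofLex x.1).2, h.1⟩ else (ofLex x.1).2)
  -- A final segment: the last cone is a copy of `Word J`, whose positive words form a copy of the
  -- product.
  let g : J ×ₗ Word J → D := fun y => ⟨toLex (b, (σ.symm (Word.consPos y) : Word J)), hlb,
    Or.inr ⟨rfl, (σ.symm (Word.consPos y)).2⟩⟩
  refine (lindenbaum f g ?_ ?_ ?_ ?_).map fun E => E.trans d.symm
  · rintro ⟨x, hx⟩ ⟨y, hy⟩ h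
    rw [← Subtype.coe_lt_coe, Prod.Lex.lt_iff] at h
    rw [Prod.Lex.lt_iff]
    rcases h with h | ⟨h₁, h₂⟩
    · exact Or.inl (e.strictMono h)
    · right
      simp only [f, ofLex_toLex]
      refine ⟨congrArg e (Subtype.ext h₁), ?_⟩
      rcases hx.2 with hxb | hxb
      · have hyb : (ofLex y).1 < b := h₁ ▸ hxb
        simp [hxb.ne, hyb.ne, h₂]
      · have hyb : (ofLex y).1 = b := h₁ ▸ hxb.1
        have hyV : (ofLex y).2 ∈ V := by
          rcases hy.2 with hy' | hy'
          · exact absurd hyb hy'.ne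
          · exact hy'.2
        simp only [hxb.1, hxb.2, hyb, hyV, true_and, dite_true]
        exact σ.strictMono h₂
  · intro x y h
    rw [← Subtype.coe_lt_coe, Prod.Lex.lt_iff]
    exact Or.inr ⟨rfl, σ.symm.strictMono (Word.consPos_strictMono h)⟩
  · rintro ⟨x, hx⟩ y h
    obtain ⟨i, hi⟩ := e.surjective (ofLex y).1
    have hix : i.1 ≤ (ofLex x).1 := by
      have : (ofLex y).1 ≤ e ⟨(ofLex x).1, hx.1⟩ := by
        rw [Prod.Lex.le_iff] at h
        rcases h with h | h
        · exact h.le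
        · exact h.1.le
      rw [← hi] at this
      exact e.le_iff_le.1 this
    have hib : i.1 ≤ b := hix.trans (by rcases hx.2 with h | h; exacts [h.le, h.1.le])
    rcases hib.lt_or_eq with hib | hib
    · refine ⟨⟨toLex (i.1, (ofLex y).2), i.2, Or.inl hib⟩, ?_⟩
      exact ofLex.injective (Prod.ext hi (dif_neg fun h => hib.ne h.2))
    · refine ⟨⟨toLex (i.1, (σ.symm (ofLex y).2 : Word J)), i.2, Or.inr ⟨hib, Subtype.prop _⟩⟩, ?_⟩
      exact ofLex.injective (Prod.ext hi
        ((dif_pos ⟨Subtype.prop _, hib⟩).trans (σ.apply_symm_apply _)))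
  · rintro y ⟨x, hx⟩ h
    rw [← Subtype.coe_le_coe, Prod.Lex.le_iff] at h
    rcases h with h | ⟨h₁, h₂⟩
    · rcases hx.2 with h' | h'
      · exact absurd h h'.not_gt
      · exact absurd h h'.1.not_gt
    · have hxb : (ofLex x).1 = b := h₁.symm
      have hxV : (ofLex x).2 ∈ V := by
        rcases hx.2 with h' | h'
        · exact absurd hxb h'.ne
        · exact h'.2
      have : Word.consPos y ≤ σ ⟨_, hxV⟩ := by
        rw [← σ.symm.le_iff_le, OrderIso.symm_apply_apply]
        exact h₂
      obtain ⟨y', hy'⟩ := exists_consPos_eq this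
      refine ⟨y', Subtype.ext ?_⟩
      simp only [g, hy', OrderIso.symm_apply_apply]
      apply ofLex.injective
      exact Prod.ext h₁ rfl

/-- The union of two consecutive copies of the set of all words is another one. -/
theorem nonempty_union_orderIso [Nonempty J] [NoMaxOrder J] {X : Type u} [LinearOrder X]
    {C D : Set X} (hC : Nonempty (C ≃o Word J)) (hD : Nonempty (D ≃o Word J))
    (hCD : ∀ x ∈ C, ∀ y ∈ D, x < y) : Nonempty ((C ∪ D : Set X) ≃o Word J) := by
  classical
  obtain ⟨σ⟩ := hC
  obtain ⟨τ⟩ := hD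
  obtain ⟨d⟩ := nonempty_words_orderIso_prod (J := J)
  obtain ⟨m, -, hm⟩ := exists_least (J := J) (P := fun _ => True) ⟨Classical.arbitrary J, trivial⟩
  obtain ⟨n, hmn, hn⟩ := exists_least (J := J) (exists_gt m)
  have hd : ∀ x : (C ∪ D : Set X), x.1 ∉ C → x.1 ∈ D := fun x hx => x.2.resolve_left hx
  -- `C` and `D` fill the cones over the two least indices `m` and `n`, an initial segment of the
  -- product. Conversely `D` ends in a copy of the product.
  let f : (C ∪ D : Set X) → J ×ₗ Word J := fun x =>
    if h : x.1 ∈ C then toLex (m, σ ⟨x, h⟩) else toLex (n, τ ⟨x, hd x h⟩)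
  let g : J ×ₗ Word J → (C ∪ D : Set X) := fun y =>
    ⟨τ.symm (Word.consPos y), Or.inr (Subtype.prop _)⟩
  have hnot : ∀ x ∈ D, x ∉ C := fun x hx hx' => lt_irrefl _ (hCD x hx' x hx)
  refine (lindenbaum f g ?_ ?_ ?_ ?_).map fun E => E.trans d.symm
  · rintro ⟨x, hx⟩ ⟨y, hy⟩ h
    rw [← Subtype.coe_lt_coe] at h
    rw [Prod.Lex.lt_iff]
    by_cases hxC : x ∈ C <;> by_cases hyC : y ∈ C
    · simp only [f, hxC, hyC, dite_true, ofLex_toLex]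
      exact Or.inr ⟨trivial, σ.strictMono h⟩
    · simp only [f, hxC, hyC, dite_true, dite_false, ofLex_toLex]
      exact Or.inl hmn
    · exact absurd h (hCD y hyC x (hd ⟨x, hx⟩ hxC)).not_gt
    · simp only [f, hxC, hyC, dite_false, ofLex_toLex]
      exact Or.inr ⟨trivial, τ.strictMono h⟩
  · intro x y h
    exact τ.symm.strictMono (Word.consPos_strictMono h)
  · intro x y h
    have hy : (ofLex y).1 ≤ n := by
      rw [Prod.Lex.le_iff] at h
      by_cases hxC : x.1 ∈ C
      · simp only [f, hxC, dite_true, ofLex_toLex] at h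
        rcases h with h | h
        exacts [(h.trans hmn).le, h.1.le.trans hmn.le]
      · simp only [f, hxC, dite_false, ofLex_toLex] at h
        rcases h with h | h
        exacts [h.le, h.1.le]
    by_cases hym : m < (ofLex y).1
    · have hy' : n = (ofLex y).1 := (hn _ hym).antisymm hy
      refine ⟨⟨τ.symm (ofLex y).2, Or.inr (Subtype.prop _)⟩, ?_⟩
      simp only [f, hnot _ (Subtype.prop (τ.symm (ofLex y).2)), dite_false, Subtype.coe_eta,
        OrderIso.apply_symm_apply]
      apply ofLex.injective
      exact Prod.ext hy' rfl
    · have hy' : m = (ofLex y).1 := (hm _ trivial).antisymm (not_lt.1 hym)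
      refine ⟨⟨σ.symm (ofLex y).2, Or.inl (Subtype.prop _)⟩, ?_⟩
      simp only [f, Subtype.prop (σ.symm (ofLex y).2), dite_true, Subtype.coe_eta,
        OrderIso.apply_symm_apply]
      apply ofLex.injective
      exact Prod.ext hy' rfl
  · rintro y ⟨x, hx⟩ h
    rw [← Subtype.coe_le_coe] at h
    have hxC : x ∉ C := fun hxC => absurd h (hCD _ hxC _ (Subtype.prop _)).not_ge
    have : Word.consPos y ≤ τ ⟨x, hd ⟨x, hx⟩ hxC⟩ := by
      rw [← τ.symm.le_iff_le, OrderIso.symm_apply_apply]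
      exact h
    obtain ⟨y', hy'⟩ := exists_consPos_eq this
    refine ⟨y', Subtype.ext ?_⟩
    simp only [g, hy', OrderIso.symm_apply_apply]

end

section
variable {J : Type u} [LinearOrder J] {K : Type v}

/-! ### Extending partial isomorphisms -/

open Classical in
/-- The position of a pair `(i, x)` relative to the points `p k`. The first component is a cut of the
family `p`; the second one is `0` for the pairs `(p k, x)` with `x ∈ midWords b`, it is `1` for the
other pairs with `i ≤ b`, and it is `2` for `b < i`. -/
noncomputable def position (p : K → J) (b : J) (x : J ×ₗ Word J) : Set K ×ₗ ℕ :=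
  if b < (ofLex x).1 then toLex (Set.univ, 2)
  else if (ofLex x).2 ∈ lowWords b then toLex ({k | p k < (ofLex x).1}, 1)
  else if (ofLex x).2 ∈ midWords b ∧ ∃ k, p k = (ofLex x).1 then toLex ({k | p k ≤ (ofLex x).1}, 0)
  else toLex ({k | p k ≤ (ofLex x).1}, 1)

theorem position_eq_zero {p : K → J} {b : J} {x : J ×ₗ Word J} {U : Set K} :
    position p b x = toLex (U, 0) ↔ (ofLex x).1 ≤ b ∧ (ofLex x).2 ∈ midWords b ∧
      ∃ k, p k = (ofLex x).1 ∧ U = {k' | p k' ≤ p k} := by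
  unfold position
  split_ifs with h₁ h₂ h₃
  · simp [h₁]
  · simp only [EmbeddingLike.apply_eq_iff_eq, Prod.mk.injEq, one_ne_zero, and_false, false_iff]
    exact fun h => not_mem_lowWords h.2.1 h₂
  · obtain ⟨h₃, k, hk⟩ := h₃
    simp only [EmbeddingLike.apply_eq_iff_eq, Prod.mk.injEq, and_true, not_lt.1 h₁, h₃, true_and]
    constructor
    · rintro rfl
      exact ⟨k, hk, by rw [hk]⟩
    · rintro ⟨k', hk', rfl⟩
      rw [hk']
  · simp only [EmbeddingLike.apply_eq_iff_eq, Prod.mk.injEq, one_ne_zero, and_false, false_iff]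
    rintro ⟨-, h, k, hk, -⟩
    exact h₃ ⟨h, k, hk⟩

theorem position_eq_one {p : K → J} {b : J} {x : J ×ₗ Word J} {U : Set K} :
    position p b x = toLex (U, 1) ↔ (ofLex x).1 ≤ b ∧
      (((ofLex x).2 ∈ lowWords b ∧ U = {k | p k < (ofLex x).1}) ∨
        ((ofLex x).2 ∉ lowWords b ∧ ¬ ((ofLex x).2 ∈ midWords b ∧ ∃ k, p k = (ofLex x).1) ∧
          U = {k | p k ≤ (ofLex x).1})) := by
  unfold position
  split_ifs with h₁ h₂ h₃
  · simp [h₁]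
  · simp [not_lt.1 h₁, h₂, eq_comm]
  · simp only [EmbeddingLike.apply_eq_iff_eq, Prod.mk.injEq, zero_ne_one, and_false, h₂, h₃]
    tauto
  · simp only [EmbeddingLike.apply_eq_iff_eq, Prod.mk.injEq, and_true, not_lt.1 h₁, h₂, h₃,
      false_and, not_false_iff, true_and, false_or, eq_comm]

theorem position_eq_two {p : K → J} {b : J} {x : J ×ₗ Word J} {U : Set K} :
    position p b x = toLex (U, 2) ↔ b < (ofLex x).1 ∧ U = Set.univ := by
  unfold position
  split_ifs with h₁ h₂ h₃ <;> simp [h₁, eq_comm]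

theorem position_ne {p : K → J} {b : J} {x : J ×ₗ Word J} {U : Set K} {n : ℕ} :
    position p b x ≠ toLex (U, n + 3) := by
  unfold position
  split_ifs <;> simp

theorem position_subset {p : K → J} {b : J} {x : J ×ₗ Word J} (h : (ofLex x).1 ≤ b) :
    {k | p k < (ofLex x).1} ⊆ (ofLex (position p b x)).1 ∧
      (ofLex (position p b x)).1 ⊆ {k | p k ≤ (ofLex x).1} := by
  unfold position
  have : {k | p k < (ofLex x).1} ⊆ {k | p k ≤ (ofLex x).1} := fun k hk => le_of_lt hk
  split_ifs with h₁ h₂ h₃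
  · exact absurd h h₁.not_ge
  · exact ⟨subset_rfl, this⟩
  · exact ⟨this, subset_rfl⟩
  · exact ⟨this, subset_rfl⟩

/-- By `position_subset` the cut can only grow with the index. If it stays the same while the index
grows, the new index is not a value `p k` lying in that cut, so the second component cannot drop to
`0`. Within one cone the low, middle and high words follow each other; over a value of `p` the cut
grows between the first two, and the second component rises between the last two. -/
theorem position_monotone (p : K → J) (b : J) : Monotone (position p b) := by
  intro x y hxy
  by_cases hy : b < (ofLex y).1
  · have hy' : position p b y = toLex (Set.univ, 2) := position_eq_two.2 ⟨hy, rfl⟩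
    rw [hy', Prod.Lex.le_iff]
    rcases (Set.subset_univ (ofLex (position p b x)).1).lt_or_eq with h | h
    · exact Or.inl h
    · refine Or.inr ⟨h, ?_⟩
      unfold position
      split_ifs <;> simp
  have hx : (ofLex x).1 ≤ b := by
    rw [Prod.Lex.le_iff] at hxy
    rcases hxy with h | h
    · exact h.le.trans (not_lt.1 hy)
    · exact h.1.le.trans (not_lt.1 hy)
  rw [not_lt] at hy
  rw [Prod.Lex.le_iff] at hxy
  rcases hxy with h | ⟨h₁, h₂⟩
  · have hsub : (ofLex (position p b x)).1 ⊆ {k | p k < (ofLex y).1} := fun k hk =>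
      ((position_subset hx).2 hk).trans_lt h
    rw [Prod.Lex.le_iff]
    rcases (hsub.trans (position_subset hy).1).lt_or_eq with h' | h'
    · exact Or.inl h'
    refine Or.inr ⟨h', ?_⟩
    have hne : (ofLex (position p b y)).2 ≠ 0 := by
      intro h0
      obtain ⟨-, -, k, hk, hU⟩ := position_eq_zero.1
        (show position p b y = toLex ((ofLex (position p b y)).1, 0) from
          ofLex.injective (Prod.ext rfl h0))
      have hk' : k ∈ (ofLex (position p b y)).1 := by
        rw [hU]
        exact le_refl (p k)
      have : p k < (ofLex y).1 := hsub (by rw [h']; exact hk')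
      exact absurd hk this.ne
    have : (ofLex (position p b x)).2 ≤ 1 := by
      unfold position
      rw [if_neg hx.not_gt]
      split_ifs <;> simp
    omega
  · have hle : {k | p k < (ofLex y).1} ≤ {k | p k ≤ (ofLex y).1} := fun k hk => le_of_lt hk
    unfold position
    rw [if_neg hx.not_gt, if_neg hy.not_gt, h₁]
    by_cases hyl : (ofLex y).2 ∈ lowWords b
    · rw [if_pos hyl, if_pos (mem_lowWords_of_le hyl h₂)]
    rw [if_neg hyl]
    by_cases hxl : (ofLex x).2 ∈ lowWords b
    · rw [if_pos hxl]
      by_cases hr : (ofLex y).2 ∈ midWords b ∧ ∃ k, p k = (ofLex y).1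
      · rw [if_pos hr, Prod.Lex.le_iff]
        obtain ⟨-, k, hk⟩ := hr
        refine Or.inl (lt_of_le_of_ne hle fun heq => ?_)
        have : k ∈ {k | p k ≤ (ofLex y).1} := hk.le
        simp only [ofLex_toLex] at heq
        rw [← heq] at this
        exact absurd hk (ne_of_lt this)
      · rw [if_neg hr, Prod.Lex.le_iff]
        rcases hle.lt_or_eq with h | h
        · exact Or.inl h
        · exact Or.inr ⟨h, le_rfl⟩
    · rw [if_neg hxl, Prod.Lex.le_iff]
      right
      split_ifs with h₃ h₄ h₄
      · simp
      · simp
      · refine absurd ?_ (not_mem_highWords h₄.1)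
        exact mem_highWords_of_le (mem_highWords_of (fun h => h₃ ⟨h, h₄.2⟩) hxl) h₂
      · simp

variable [WellFoundedLT J]

/-- The gap at the cut `U` ends at `c`. If `c` is the next value of `p`, only the low part of its
cone belongs to the gap; if there is no next value, `c = b` and the whole cone does. The gap splits
into the high part `C` of the cone over the last value of `p` on `U`, present only if there is one,
and a block `D` of cones from `l` to `c`. The block is nonempty even if `l = c`, because `V` is a
copy of `Word J`. -/
theorem nonempty_fiber_orderIso_aux [Nonempty J] [NoMaxOrder J]
    (hJ : ∀ b : J, Nonempty (Set.Ici b ≃o J)) {p : K → J} {b c : J} {U : Set K} {V : Set (Word J)}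
    (hp : ∀ k, p k < b) (hU : ∀ k, k ∈ U ↔ p k < c) (hc : c ≤ b)
    (hV : (c = b ∧ V = Set.univ) ∨ ((∃ k, p k = c) ∧ V = lowWords b)) :
    Nonempty ({x | position p b x = toLex (U, 1)} ≃o Word J) := by
  -- `l` is the first index above all `p k` with `k ∈ U`. No value of `p` lies in `[l, c)`.
  obtain ⟨l, hl, hlmin⟩ := exists_least (J := J) (P := fun i => ∀ k ∈ U, p k < i)
    ⟨c, fun k hk => (hU k).1 hk⟩
  have hlc : l ≤ c := hlmin c fun k hk => (hU k).1 hk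
  have hVc : Nonempty (V ≃o Word J) := by
    rcases hV with ⟨-, rfl⟩ | ⟨-, rfl⟩
    · exact ⟨OrderIso.Set.univ⟩
    · exact nonempty_lowWords_orderIso b
  set D := {x : J ×ₗ Word J | l ≤ (ofLex x).1 ∧
      ((ofLex x).1 < c ∨ ((ofLex x).1 = c ∧ (ofLex x).2 ∈ V))} with hD
  have hDc : Nonempty (D ≃o Word J) := nonempty_block_orderIso hJ hlc hVc
  set C := {x : J ×ₗ Word J | (∃ k, p k = (ofLex x).1) ∧ (ofLex x).2 ∈ highWords b ∧
    U = {k | p k ≤ (ofLex x).1}} with hC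
  have hCD : ∀ x ∈ C, ∀ y ∈ D, x < y := by
    rintro x ⟨⟨k, hk⟩, -, hx⟩ y ⟨hy, -⟩
    rw [Prod.Lex.lt_iff]
    left
    rw [← hk]
    exact (hl k (by rw [hx]; exact hk.le)).trans_le hy
  have hfib : {x | position p b x = toLex (U, 1)} = C ∪ D := by
    ext x
    rw [Set.mem_ofPred_eq, position_eq_one]
    constructor
    · rintro ⟨hxb, ⟨hx, hxU⟩ | ⟨hx, hx', hxU⟩⟩
      · right
        refine ⟨hlmin _ fun k hk => by rw [hxU] at hk; exact hk, ?_⟩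
        rcases hV with ⟨rfl, rfl⟩ | ⟨⟨k, rfl⟩, rfl⟩
        · rcases hxb.lt_or_eq with h | h
          · exact Or.inl h
          · exact Or.inr ⟨h, trivial⟩
        · have : ¬ p k < (ofLex x).1 := fun h => by
            have h' : k ∈ U := by rw [hxU]; exact h
            exact lt_irrefl _ ((hU k).1 h')
          rcases (not_lt.1 this).lt_or_eq with h | h
          · exact Or.inl h
          · exact Or.inr ⟨h, hx⟩
      · by_cases hr : ∃ k, p k = (ofLex x).1
        · exact Or.inl ⟨hr, mem_highWords_of (fun h => hx' ⟨h, hr⟩) hx, hxU⟩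
        · right
          refine ⟨hlmin _ fun k hk => ?_, ?_⟩
          · rw [hxU] at hk
            exact lt_of_le_of_ne hk fun h => hr ⟨k, h⟩
          · rcases hV with ⟨rfl, rfl⟩ | ⟨⟨k, rfl⟩, rfl⟩
            · rcases hxb.lt_or_eq with h | h
              · exact Or.inl h
              · exact Or.inr ⟨h, trivial⟩
            · left
              refine not_le.1 fun h => ?_
              have h' : k ∈ U := by rw [hxU]; exact h
              exact lt_irrefl _ ((hU k).1 h')
    · rintro (⟨⟨k, hk⟩, hx, hxU⟩ | ⟨hx, hx'⟩)
      · refine ⟨hk ▸ (hp k).le, Or.inr ⟨fun h => ?_, fun h => not_mem_highWords h.1 hx, hxU⟩⟩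
        obtain ⟨i, z, -, hz⟩ := hx
        rw [hz, cons_mem_lowWords] at h
        exact absurd h.1 (by simp)
      · rcases hx' with hx' | ⟨hx', hxV⟩
        · refine ⟨hx'.le.trans hc, ?_⟩
          have hlt : U = {k | p k < (ofLex x).1} := by
            ext k
            exact ⟨fun h => (hl k h).trans_le hx, fun h => (hU k).2 (lt_trans h hx')⟩
          have hle : U = {k | p k ≤ (ofLex x).1} := by
            ext k
            exact ⟨fun h => ((hl k h).trans_le hx).le, fun h => (hU k).2 (lt_of_le_of_lt h hx')⟩
          by_cases hlow : (ofLex x).2 ∈ lowWords b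
          · exact Or.inl ⟨hlow, hlt⟩
          · refine Or.inr ⟨hlow, ?_, hle⟩
            rintro ⟨-, k, hk⟩
            have : k ∈ U := by rw [hle]; exact hk.le
            exact absurd hk ((hl k this).trans_le hx).ne
        · refine ⟨hx'.le.trans hc, ?_⟩
          by_cases hlow : (ofLex x).2 ∈ lowWords b
          · refine Or.inl ⟨hlow, ?_⟩
            ext k
            rw [hx']
            exact hU k
          · rcases hV with ⟨rfl, rfl⟩ | ⟨-, rfl⟩
            · refine Or.inr ⟨hlow, fun h => ?_, ?_⟩
              · obtain ⟨k, hk⟩ := h.2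
                exact absurd (hk.trans hx') (hp k).ne
              · ext k
                rw [hx', hU k]
                exact ⟨fun h => le_of_lt h, fun _ => hp k⟩
            · exact absurd hxV hlow
  rw [hfib]
  rcases C.eq_empty_or_nonempty with h | ⟨x₀, hx₀⟩
  · rw [h, Set.empty_union]
    exact hDc
  · refine nonempty_union_orderIso ?_ hDc hCD
    have hCe : ∀ x ∈ C, ∀ y ∈ C, (ofLex x).1 ≤ (ofLex y).1 := by
      rintro x ⟨⟨k, hk⟩, -, hxU⟩ y ⟨⟨k', hk'⟩, -, hyU⟩
      rw [← hk]
      have : k ∈ U := by rw [hxU]; exact hk.le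
      rw [hyU] at this
      exact this
    obtain ⟨e⟩ := nonempty_highWords_orderIso b
    let f : C → highWords b := fun x => ⟨(ofLex x.1).2, x.2.2.1⟩
    refine ⟨(StrictMono.orderIsoOfSurjective f ?_ ?_).trans e⟩
    · rintro ⟨x, hx⟩ ⟨y, hy⟩ h
      rw [← Subtype.coe_lt_coe, Prod.Lex.lt_iff] at h
      rcases h with h | h
      · exact absurd h (hCe y hy x hx).not_gt
      · exact h.2
    · rintro ⟨y, hy⟩
      exact ⟨⟨toLex ((ofLex x₀).1, y), hx₀.1, hy, hx₀.2.2⟩, rfl⟩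

theorem nonempty_fiber_orderIso [Nonempty J] [NoMaxOrder J]
    (hJ : ∀ b : J, Nonempty (Set.Ici b ≃o J)) {p : K → J} {b : J} {U : Set K}
    (hp : ∀ k, p k < b) (hU : ∀ k k', p k ≤ p k' → k' ∈ U → k ∈ U) :
    Nonempty ({x | position p b x = toLex (U, 1)} ≃o Word J) := by
  by_cases h : U = Set.univ
  · exact nonempty_fiber_orderIso_aux hJ (c := b) hp (fun k => by simp [h, hp k]) le_rfl
      (Or.inl ⟨rfl, rfl⟩)
  · obtain ⟨k, hk⟩ := (Set.ne_univ_iff_exists_notMem U).1 h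
    obtain ⟨c, ⟨k₁, hk₁, rfl⟩, hmin⟩ := exists_least (J := J) (P := fun i => ∃ k, k ∉ U ∧ p k = i)
      ⟨_, k, hk, rfl⟩
    refine nonempty_fiber_orderIso_aux hJ (c := p k₁) hp (fun k => ⟨fun hk => ?_, fun hk => ?_⟩)
      (hp k₁).le (Or.inr ⟨⟨k₁, rfl⟩, rfl⟩)
    · exact not_le.1 fun h => hk₁ (hU _ _ h hk)
    · by_contra hk'
      exact absurd hk (hmin _ ⟨k, hk', rfl⟩).not_gt

/-- Glue along the fibres of `position`. By `hpq` both families have the same cuts. Cores are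
matched by exchanging `p k` for `q k`, gaps because both are copies of `Word J`, and the part above
`b` is kept fixed, which the recursion on words needs later. -/
theorem exists_orderIso_prod [Nonempty J] [NoMaxOrder J]
    (hJ : ∀ b : J, Nonempty (Set.Ici b ≃o J)) {p q : K → J} {b : J} (hp : ∀ k, p k < b)
    (hq : ∀ k, q k < b) (hpq : ∀ k k', p k ≤ p k' ↔ q k ≤ q k') :
    ∃ E : J ×ₗ Word J ≃o J ×ₗ Word J,
      (∀ k, ∀ y ∈ midWords b, E (toLex (p k, y)) = toLex (q k, y)) ∧
      ∀ i y, b < i → E (toLex (i, y)) = toLex (i, y) := by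
  -- `R` records the prescribed values so that they survive the gluing. It demands nothing of points
  -- in a gap.
  let R : J ×ₗ Word J → J ×ₗ Word J → Prop := fun x y =>
    (∀ k, p k = (ofLex x).1 → (ofLex x).2 ∈ midWords b → y = toLex (q k, (ofLex x).2)) ∧
      (b < (ofLex x).1 → y = x)
  have key := exists_orderIso_of_fiber (position_monotone p b) (position_monotone q b) R ?_
  · obtain ⟨E, hE⟩ := key
    exact ⟨E, fun k y hy => (hE _).1 k rfl hy, fun i y hi => (hE _).2 hi⟩
  have hempty : ∀ z, (∀ x, position p b x ≠ z) → (∀ x, position q b x ≠ z) →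
      ∃ e : {x | position p b x = z} ≃o {y | position q b y = z},
        ∀ x : {x | position p b x = z}, R x (e x) := by
    intro z h₁ h₂
    have : IsEmpty {x | position p b x = z} := ⟨fun x => h₁ x.1 x.2⟩
    have : IsEmpty {x | position q b x = z} := ⟨fun x => h₂ x.1 x.2⟩
    exact ⟨OrderIso.ofIsEmpty _ _, fun x => isEmptyElim x⟩
  intro z
  obtain ⟨⟨U, n⟩, rfl⟩ := toLex.surjective z
  match n with
  | 0 =>
    by_cases hU : ∃ k, U = {k' | p k' ≤ p k}
    · obtain ⟨k₀, hU⟩ := hU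
      have hU' : U = {k' | q k' ≤ q k₀} := by
        rw [hU]
        ext k
        exact hpq k k₀
      have hx₀ : ∀ x, position p b x = toLex (U, 0) →
          (ofLex x).1 = p k₀ ∧ (ofLex x).2 ∈ midWords b := by
        intro x hx
        obtain ⟨-, hx, k, hk, hk'⟩ := position_eq_zero.1 hx
        have h₁ : k ∈ U := by rw [hk']; exact le_refl (p k)
        have h₂ : k₀ ∈ U := by rw [hU]; exact le_refl (p k₀)
        rw [hU] at h₁
        rw [hk'] at h₂
        exact ⟨hk ▸ le_antisymm h₁ h₂, hx⟩
      have hy₀ : ∀ x, position q b x = toLex (U, 0) →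
          (ofLex x).1 = q k₀ ∧ (ofLex x).2 ∈ midWords b := by
        intro x hx
        obtain ⟨-, hx, k, hk, hk'⟩ := position_eq_zero.1 hx
        have h₁ : k ∈ U := by rw [hk']; exact le_refl (q k)
        have h₂ : k₀ ∈ U := by rw [hU']; exact le_refl (q k₀)
        rw [hU'] at h₁
        rw [hk'] at h₂
        exact ⟨hk ▸ le_antisymm h₁ h₂, hx⟩
      let f : {x | position p b x = toLex (U, 0)} → {y | position q b y = toLex (U, 0)} :=
        fun x => ⟨toLex (q k₀, (ofLex x.1).2), position_eq_zero.2
          ⟨(hq k₀).le, (hx₀ x.1 x.2).2, k₀, rfl, hU'⟩⟩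
      refine ⟨StrictMono.orderIsoOfSurjective f ?_ ?_, ?_⟩
      · rintro ⟨x, hx⟩ ⟨y, hy⟩ h
        rw [← Subtype.coe_lt_coe, Prod.Lex.lt_iff] at h ⊢
        refine Or.inr ⟨rfl, ?_⟩
        rcases h with h | h
        · exact absurd ((hx₀ x hx).1.trans (hx₀ y hy).1.symm) h.ne
        · exact h.2
      · rintro ⟨y, hy⟩
        refine ⟨⟨toLex (p k₀, (ofLex y).2), position_eq_zero.2
          ⟨(hp k₀).le, (hy₀ y hy).2, k₀, rfl, hU⟩⟩, Subtype.ext ?_⟩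
        exact ofLex.injective (Prod.ext (hy₀ y hy).1.symm rfl)
      · rintro ⟨x, hx⟩
        have hx' := hx₀ x hx
        refine ⟨fun k hk _ => ?_, fun h => ?_⟩
        · have hkk : p k = p k₀ := hk.trans hx'.1
          have : q k = q k₀ := le_antisymm ((hpq _ _).1 hkk.le) ((hpq _ _).1 hkk.ge)
          rw [this]
          rfl
        · simp only at h
          rw [hx'.1] at h
          exact absurd h (hp k₀).not_gt
    · refine hempty _ (fun x hx => ?_) (fun x hx => ?_)
      · obtain ⟨-, -, k, -, hk⟩ := position_eq_zero.1 hx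
        exact hU ⟨k, hk⟩
      · obtain ⟨-, -, k, -, hk⟩ := position_eq_zero.1 hx
        refine hU ⟨k, hk.trans ?_⟩
        ext k'
        exact (hpq k' k).symm
  | 1 =>
    by_cases hU : ∀ k k', p k ≤ p k' → k' ∈ U → k ∈ U
    · obtain ⟨e₁⟩ := nonempty_fiber_orderIso hJ hp hU
      obtain ⟨e₂⟩ := nonempty_fiber_orderIso hJ hq
        (fun k k' h => hU k k' ((hpq k k').2 h))
      refine ⟨e₁.trans e₂.symm, ?_⟩
      rintro ⟨x, hx⟩
      obtain ⟨hxb, hx⟩ := position_eq_one.1 hx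
      refine ⟨fun k hk hm => ?_, fun h => absurd hxb h.not_ge⟩
      rcases hx with hx | hx
      · exact absurd hx.1 (not_mem_lowWords hm)
      · exact absurd ⟨hm, k, hk⟩ hx.2.1
    · have aux : ∀ r : K → J, ∀ x, position r b x = toLex (U, 1) →
          ∀ k k', r k ≤ r k' → k' ∈ U → k ∈ U := by
        intro r x hx k k' hkk' hk'
        obtain ⟨-, ⟨-, h⟩ | ⟨-, -, h⟩⟩ := position_eq_one.1 hx
        · rw [h] at hk' ⊢
          exact lt_of_le_of_lt hkk' hk'
        · rw [h] at hk' ⊢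
          exact le_trans hkk' hk'
      exact hempty _ (fun x hx => hU (aux p x hx))
        (fun x hx => hU fun k k' h => aux q x hx k k' ((hpq k k').1 h))
  | 2 =>
    have : {x | position p b x = toLex (U, 2)} = {x | position q b x = toLex (U, 2)} := by
      ext x
      rw [Set.mem_ofPred_eq, Set.mem_ofPred_eq, position_eq_two, position_eq_two]
    refine ⟨OrderIso.setCongr _ _ this, ?_⟩
    rintro ⟨x, hx⟩
    refine ⟨fun k hk _ => ?_, fun _ => rfl⟩
    have := (position_eq_two.1 hx).1
    simp only at hk
    rw [← hk] at this
    exact absurd this (hp k).not_gt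
  | n + 3 => exact hempty _ (fun _ => position_ne) (fun _ => position_ne)

end

/-! ### From first letters to whole words -/

section
variable {J : Type u} [LinearOrder J] {K : Type v}

/-- Changing all signs in a word. -/
def Word.flip {J : Type u} (x : Word J) : Word J := wordNeg x

@[simp] theorem Word.flip_flip {J : Type u} (x : Word J) : x.flip.flip = x := wordNeg_wordNeg x

theorem Word.flip_cons {J : Type u} (a : Bool × J) (x : Word J) :
    (Word.cons a x).flip = Word.cons (!a.1, a.2) x.flip := rfl

theorem Word.flip_lt {x y : Word J} : x.flip < y.flip ↔ y < x := wordLT_wordNeg x y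

theorem Word.nil_lt_consPos (x : J ×ₗ Word J) : Word.nil < Word.consPos x := Word.nil_lt_cons.2 rfl

theorem Word.flip_consPos_lt_nil (x : J ×ₗ Word J) :
    (Word.consPos x).flip < Word.nil := Word.cons_lt_nil.2 rfl

/-- An automorphism of the set of words with a positive first letter induces one of the set of all
words, symmetric under change of signs at the first letter. -/
theorem exists_orderIso_word (e : J ×ₗ Word J ≃o J ×ₗ Word J) :
    ∃ E : Word J ≃o Word J, E Word.nil = Word.nil ∧
      (∀ i y, E (Word.cons (true, i) y) = Word.consPos (e (toLex (i, y)))) ∧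
      ∀ i y, E (Word.cons (false, i) y) =
        (Word.consPos (e (toLex (i, y.flip)))).flip := by
  let f : Word J → Word J := fun x => match x with
    | [] => Word.nil
    | (true, i) :: y => Word.consPos (e (toLex (i, (y : Word J))))
    | (false, i) :: y => (Word.consPos (e (toLex (i, Word.flip y)))).flip
  have hnil : f Word.nil = Word.nil := rfl
  have ht : ∀ i y, f (Word.cons (true, i) y) = Word.consPos (e (toLex (i, y))) := fun _ _ => rfl
  have hf : ∀ i y, f (Word.cons (false, i) y) =
        (Word.consPos (e (toLex (i, y.flip)))).flip := fun _ _ => rfl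
  have hmono : StrictMono f := by
    intro x y h
    induction x using Word.ind with
    | nil =>
      induction y using Word.ind with
      | nil => exact absurd h (lt_irrefl _)
      | cons a y =>
        obtain ⟨s, i⟩ := a
        obtain rfl : s = true := Word.nil_lt_cons.1 h
        rw [hnil, ht]
        exact Word.nil_lt_consPos _
    | cons a x =>
      obtain ⟨s, i⟩ := a
      induction y using Word.ind with
      | nil =>
        obtain rfl : s = false := Word.cons_lt_nil.1 h
        rw [hnil, hf]
        exact Word.flip_consPos_lt_nil _
      | cons a y =>
        obtain ⟨t, j⟩ := a
        cases s <;> cases t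
        · rw [hf, hf, Word.flip_lt]
          apply Word.consPos_strictMono
          apply e.strictMono
          rw [Prod.Lex.lt_iff]
          rcases Word.cons_lt_cons.1 h with h | h
          · exact Or.inl h
          · simp only [Prod.mk.injEq, true_and] at h
            exact Or.inr ⟨h.1.symm, Word.flip_lt.2 h.2⟩
        · rw [hf, ht]
          exact lt_trans (Word.flip_consPos_lt_nil _) (Word.nil_lt_consPos _)
        · rcases Word.cons_lt_cons.1 h with h | h
          · exact h.elim
          · simp at h
        · rw [ht, ht]
          apply Word.consPos_strictMono
          apply e.strictMono
          rw [Prod.Lex.lt_iff]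
          rcases Word.cons_lt_cons.1 h with h | h
          · exact Or.inl h
          · simp only [Prod.mk.injEq, true_and] at h
            exact Or.inr h
  have hsurj : Function.Surjective f := by
    intro y
    induction y using Word.ind with
    | nil => exact ⟨Word.nil, rfl⟩
    | cons a y =>
      obtain ⟨s, i⟩ := a
      cases s
      · obtain ⟨z, hz⟩ := e.surjective (toLex (i, y.flip))
        refine ⟨Word.cons (false, (ofLex z).1) (ofLex z).2.flip, ?_⟩
        rw [hf, Word.flip_flip]
        erw [hz]
        change (Word.cons (true, i) y.flip).flip = _
        rw [Word.flip_cons, Word.flip_flip]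
        rfl
      · obtain ⟨z, hz⟩ := e.surjective (toLex (i, y))
        refine ⟨Word.cons (true, (ofLex z).1) (ofLex z).2, ?_⟩
        rw [ht]
        erw [hz]
        rfl
  exact ⟨StrictMono.orderIsoOfSurjective f hmono hsurj, hnil, ht, hf⟩

theorem flip_mem_midWords {b : J} {x : Word J} (h : x ∈ midWords b) :
    x.flip ∈ midWords b := by
  induction x using Word.ind with
  | nil => exact h
  | cons a x =>
    rw [Word.flip_cons]
    rw [cons_mem_midWords] at h ⊢
    exact h

/-- Given an automorphism `E` of the set of words, apply it hereditarily below the letters whose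
index satisfies `P`. -/
noncomputable def hereditary (E : Word J → Word J) (P : J → Prop) [DecidablePred P] :
    List (Bool × J) → Word J
  | [] => E Word.nil
  | a :: y => if P a.2 then E (Word.cons a (hereditary E P y)) else E (Word.cons a y)

/-- Order-isomorphic bounded families of indices are conjugate under an automorphism of the order of
words, uniformly in all words over these families. -/
theorem exists_orderIso_map [WellFoundedLT J] [Nonempty J] [NoMaxOrder J]
    (hJ : ∀ b : J, Nonempty (Set.Ici b ≃o J)) {p q : K → J} {b : J} (hp : ∀ k, p k < b)
    (hq : ∀ k, q k < b) (hpq : ∀ k k', p k ≤ p k' ↔ q k ≤ q k') :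
    ∃ G : Word J ≃o Word J, ∀ w : Word K, G (w.map p) = w.map q := by
  classical
  obtain ⟨e, he, he'⟩ := exists_orderIso_prod hJ hp hq hpq
  obtain ⟨E, hE₀, hE₁, hE₂⟩ := exists_orderIso_word e
  have hcore : ∀ s k, ∀ y ∈ midWords b, E (Word.cons (s, p k) y) = Word.cons (s, q k) y := by
    intro s k y hy
    cases s
    · rw [hE₂, he _ _ (flip_mem_midWords hy)]
      change (Word.cons (true, q k) y.flip).flip = _
      rw [Word.flip_cons, Word.flip_flip]
      rfl
    · rw [hE₁, he _ _ hy]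
      rfl
  have hid : ∀ a y, b < a.2 → E (Word.cons a y) = Word.cons a y := by
    rintro ⟨s, i⟩ y hi
    cases s
    · rw [hE₂, he' i _ hi]
      change (Word.cons (true, i) y.flip).flip = _
      rw [Word.flip_cons, Word.flip_flip]
      rfl
    · rw [hE₁, he' i _ hi]
      rfl
  -- `E` fixes every word outside `midWords b`, and hence preserves `midWords b` in both directions.
  have hid' : ∀ y, y ∉ midWords b → E y = y := by
    intro y hy
    induction y using Word.ind with
    | nil => exact hE₀
    | cons a y => exact hid a y (not_le.1 fun h => hy (cons_mem_midWords.2 h))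
  have hmid : ∀ y, E y ∈ midWords b → y ∈ midWords b := by
    intro y hy
    by_contra h
    rw [hid' y h] at hy
    exact h hy
  have hmid' : ∀ y ∈ midWords b, E y ∈ midWords b := by
    intro y hy
    by_contra h
    have := hid' _ h
    rw [E.injective this] at h
    exact h hy
  let P : J → Prop := fun i => ∃ k, p k = i
  let G : Word J → Word J := hereditary E P
  have hG₀ : G Word.nil = Word.nil := hE₀
  have hG₁ : ∀ s k y, G (Word.cons (s, p k) y) = E (Word.cons (s, p k) (G y)) :=
    fun s k y => if_pos ⟨k, rfl⟩
  have hG₂ : ∀ a y, ¬ P a.2 → G (Word.cons a y) = E (Word.cons a y) := fun a y h => if_neg h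
  have hGid : ∀ y, y ∉ midWords b → G y = y := by
    intro y hy
    induction y using Word.ind with
    | nil => exact hG₀
    | cons a y =>
      rw [cons_mem_midWords, not_le] at hy
      rw [hG₂ _ _ (by rintro ⟨k, hk⟩; exact absurd hy (hk ▸ (hp k).not_gt)), hid _ _ hy]
  -- `G` differs from `E` only behind the first letter, so comparisons decided at the first letter
  -- are inherited from `E`.
  have hlift : ∀ a y, ∃ z, G (Word.cons a y) = E (Word.cons a z) := by
    intro a y
    by_cases h : P a.2
    · obtain ⟨s, i⟩ := a
      obtain ⟨k, rfl⟩ := h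
      exact ⟨_, hG₁ s k y⟩
    · exact ⟨_, hG₂ a y h⟩
  have hmono : StrictMono G := by
    intro x
    induction x using Word.ind with
    | nil =>
      intro y hy
      induction y using Word.ind with
      | nil => exact absurd hy (lt_irrefl _)
      | cons a y =>
        obtain ⟨z, hz⟩ := hlift a y
        rw [hz, hG₀, ← hE₀]
        exact E.strictMono (Word.nil_lt_cons.2 (Word.nil_lt_cons.1 hy))
    | cons a x ih =>
      intro y hy
      induction y using Word.ind with
      | nil =>
        obtain ⟨z, hz⟩ := hlift a x
        rw [hz, hG₀, ← hE₀]
        exact E.strictMono (Word.cons_lt_nil.2 (Word.cons_lt_nil.1 hy))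
      | cons c y =>
        rcases Word.cons_lt_cons.1 hy with h | ⟨rfl, h⟩
        · obtain ⟨z, hz⟩ := hlift a x
          obtain ⟨z', hz'⟩ := hlift c y
          rw [hz, hz']
          exact E.strictMono (Word.cons_lt_cons.2 (Or.inl h))
        · by_cases hP : P a.2
          · obtain ⟨s, i⟩ := a
            obtain ⟨k, rfl⟩ := hP
            rw [hG₁, hG₁]
            exact E.strictMono (Word.cons_lt_cons.2 (Or.inr ⟨rfl, ih h⟩))
          · rw [hG₂ _ _ hP, hG₂ _ _ hP]
            exact E.strictMono (Word.cons_lt_cons.2 (Or.inr ⟨rfl, h⟩))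
  have hmap : ∀ w : Word K, w.map q ∈ midWords b := by
    intro w
    induction w using Word.ind with
    | nil => exact nil_mem_midWords b
    | cons a w =>
      rw [Word.map_cons, cons_mem_midWords]
      exact (hq a.2).le
  have hsurj : Function.Surjective G := by
    intro y
    induction y using Word.ind with
    | nil => exact ⟨_, hG₀⟩
    | cons a y ih =>
      obtain ⟨x, hx⟩ := E.surjective (Word.cons a y)
      induction x using Word.ind with
      | nil => exact ⟨Word.nil, hG₀.trans (hE₀ ▸ hx)⟩
      | cons c z =>
        by_cases hP : P c.2
        · obtain ⟨s, i⟩ := c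
          obtain ⟨k, rfl⟩ := hP
          -- Inside the core, `E` has changed only the first letter, so `z` is the tail `y` and the
          -- induction hypothesis applies. Outside it, `G` fixes `z` and nothing has to be
          -- corrected.
          by_cases hz : z ∈ midWords b
          · rw [hcore _ _ _ hz] at hx
            obtain ⟨rfl, rfl⟩ := Word.cons_inj.1 hx
            obtain ⟨z', hz'⟩ := ih
            refine ⟨Word.cons (s, p k) z', ?_⟩
            rw [hG₁, hz', hcore _ _ _ hz]
          · refine ⟨Word.cons (s, p k) z, ?_⟩
            rw [hG₁, hGid z hz, hx]
        · exact ⟨Word.cons c z, (hG₂ _ _ hP).trans hx⟩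
  refine ⟨StrictMono.orderIsoOfSurjective G hmono hsurj, fun w => ?_⟩
  change G _ = _
  induction w using Word.ind with
  | nil => exact hG₀
  | cons a w ih => rw [Word.map_cons, Word.map_cons, hG₁, ih, hcore _ _ _ (hmap w)]

end

/-! ### Letters of words -/

section
variable {J : Type u}

/-- The set of indices of letters of a word. -/
def Word.letters (w : Word J) : Set J := {i | ∃ s, (s, i) ∈ (show List (Bool × J) from w)}

theorem Word.letters_finite (w : Word J) : w.letters.Finite := by
  refine ((List.finite_toSet (show List (Bool × J) from w)).image Prod.snd).subset ?_
  rintro i ⟨s, h⟩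
  exact ⟨(s, i), h, rfl⟩

theorem Word.exists_map {K : Type v} {p : K → J} {w : Word J} (h : ∀ i ∈ w.letters, ∃ k, p k = i) :
    ∃ w' : Word K, w'.map p = w := by
  induction w using Word.ind with
  | nil => exact ⟨Word.nil, rfl⟩
  | cons a w ih =>
    obtain ⟨w', rfl⟩ := ih fun i ⟨s, hi⟩ => h i ⟨s, List.mem_cons_of_mem _ hi⟩
    obtain ⟨k, hk⟩ := h a.2 ⟨a.1, List.mem_cons_self⟩
    exact ⟨Word.cons (a.1, k) w', by rw [Word.map_cons, hk]⟩

/-- The word of positions with the same signs. -/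
def Word.skeleton (w : Word J) : Word ℕ :=
  List.mapIdx (fun n (a : Bool × J) => (a.1, n)) w

/-- The index of the letter at a position, with a default value beyond the end. -/
def Word.letterAt (d : J) (w : Word J) (n : ℕ) : J :=
  (List.getD (α := Bool × J) w n (true, d)).2

theorem Word.map_skeleton (d : J) (w : Word J) : w.skeleton.map (w.letterAt d) = w := by
  have h : ∀ l : List (Bool × J), (l.mapIdx fun n a => (a.1, n)).map
      (fun a => (a.1, (l.getD a.2 (true, d)).2)) = l := fun l => by
    apply List.ext_getElem
    · simp
    · intro n h₁ h₂
      simp [List.getElem?_eq_getElem h₂]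
  exact h w

theorem Word.skeleton_map {K : Type v} (f : J → K) (w : Word J) :
    (w.map f).skeleton = w.skeleton := by
  have h : ∀ l : List (Bool × J), ((l.map fun a => (a.1, f a.2)).mapIdx fun n a => (a.1, n)) =
      l.mapIdx fun n a => (a.1, n) := fun l => by
    apply List.ext_getElem
    · simp
    · intro n h₁ h₂
      simp
  exact h w

theorem Word.letterAt_map {K : Type v} (f : J → K) (d : J) (w : Word J) (n : ℕ) :
    (w.map f).letterAt (f d) n = f (w.letterAt d n) := by
  have h : ∀ l : List (Bool × J), ((l.map fun a => (a.1, f a.2)).getD n (true, f d)).2 =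
      f (l.getD n (true, d)).2 := fun l => by
    by_cases h : n < l.length
    · simp [List.getElem?_eq_getElem h]
    · simp [List.getElem?_eq_none (not_lt.1 h)]
  exact h w

theorem Word.letterAt_mem (d : J) (w : Word J) (n : ℕ) :
    w.letterAt d n = d ∨ w.letterAt d n ∈ w.letters := by
  have h : ∀ l : List (Bool × J), (l.getD n (true, d)).2 = d ∨
      ∃ s, (s, (l.getD n (true, d)).2) ∈ l := fun l => by
    by_cases h : n < l.length
    · exact Or.inr ⟨l[n].1, by simp [List.getElem?_eq_getElem h]⟩
    · simp [List.getElem?_eq_none (not_lt.1 h)]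
  exact h w

theorem mk_word_le {c : Cardinal.{u}} (hc : ℵ₀ ≤ c) (hJ : #J ≤ c) : #(Word J) ≤ c := by
  refine (mk_list_le_max (Bool × J)).trans (max_le hc ?_)
  rw [mk_prod, lift_id', mk_bool]
  simp only [lift_ofNat]
  exact mul_le_of_le hc ((natCast_lt_aleph0 (n := 2)).le.trans hc) hJ

theorem mk_iUnion_letters_le {ι : Type u} (s : ι → Word J) {c : Cardinal.{u}} (hc : ℵ₀ ≤ c)
    (hι : #ι ≤ c) : #(⋃ i, (s i).letters : Set J) ≤ c := by
  refine mk_iUnion_le_sum_mk.trans ((sum_le_mk_mul_iSup _).trans ?_)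
  refine mul_le_of_le hc hι ?_
  exact ciSup_le' fun i => ((s i).letters_finite.countable.le_aleph0).trans hc

theorem mk_iUnion_letters_lt (A : Set (Word J)) {c : Cardinal.{u}} (hc : ℵ₀ < c)
    (hA : #A < c) : #(⋃ x : A, x.1.letters : Set J) < c :=
  (mk_iUnion_letters_le (fun x : A => x.1) (c := max ℵ₀ #A) (le_max_left _ _)
    (le_max_right _ _)).trans_lt (max_lt hc hA)

end

theorem mk_quotient_le {α : Type u} {β : Type u} (r : Setoid α) (f : α → β)
    (h : ∀ a b, f a = f b → r a b) : #(Quotient r) ≤ #β := by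
  refine mk_le_of_injective (f := fun x => f x.out) fun x y hxy => ?_
  rw [← x.out_eq, ← y.out_eq]
  exact Quotient.sound (h _ _ hxy)

section
variable {J : Type u} [LinearOrder J] [WellFoundedLT J]

/-! ### Orbits of long sequences -/

/-- A sequence is determined up to automorphism by the sign patterns of its words and the order
pattern of all their letters, a binary relation on `ι × ℕ`. Reading the default letter `d` beyond
the end of a word only refines the invariant. -/
theorem mk_quotient_autSetoid_empty [Nonempty J] [NoMaxOrder J]
    (hJ : ∀ b : J, Nonempty (Set.Ici b ≃o J)) {ι : Type u}
    (hι : ℵ₀ ≤ #ι) (hb : ∀ T : Set J, #T ≤ #ι → ∃ b, ∀ x ∈ T, x < b) :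
    #(Quotient (autSetoid (∅ : Set (Word J)) ι)) ≤ 2 ^ #ι := by
  obtain ⟨d⟩ := ‹Nonempty J›
  let p : (ι → Word J) → ι × ℕ → J := fun s k => (s k.1).letterAt d k.2
  have hp : ∀ (s : ι → Word J) i,
      ((s i).skeleton.map fun n => (i, n)).map (p s) = s i := by
    intro s i
    rw [Word.map_map]
    exact Word.map_skeleton d (s i)
  have hprod : #(ι × ℕ) = #ι := by
    rw [mk_prod, lift_uzero, mk_nat, lift_aleph0, mul_aleph0_eq hι]
  have hrange : ∀ s, #(Set.range (p s)) ≤ #ι := fun s => mk_range_le.trans hprod.le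
  refine (mk_quotient_le (β := (ι → Word (ULift.{u} ℕ)) × Set ((ι × ℕ) × (ι × ℕ))) _
    (fun s => (fun i => (s i).skeleton.map ULift.up, {k | p s k.1 ≤ p s k.2})) ?_).trans ?_
  · intro s t h
    simp only [Prod.mk.injEq] at h
    have h₁ : ∀ i, (s i).skeleton = (t i).skeleton := fun i => by
      have := congrArg (Word.map ULift.down) (congrFun h.1 i)
      rw [Word.map_map, Word.map_map] at this
      have hid : ∀ w : Word ℕ, w.map (ULift.down.{u} ∘ ULift.up) = w := List.map_id
      rwa [hid, hid] at this
    have h₂ : ∀ k k', p s k ≤ p s k' ↔ p t k ≤ p t k' := fun k k' => Set.ext_iff.1 h.2 (k, k')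
    obtain ⟨b, hb⟩ := hb (Set.range (p s) ∪ Set.range (p t))
      ((mk_union_le _ _).trans (add_le_of_le hι (hrange s) (hrange t)))
    obtain ⟨G, hG⟩ := exists_orderIso_map hJ (fun k => hb _ (Or.inl ⟨k, rfl⟩))
      (fun k => hb _ (Or.inr ⟨k, rfl⟩)) h₂
    refine ⟨G, by simp, fun i => ?_⟩
    conv_lhs => rw [← hp s i]
    rw [hG, h₁, hp]
  · rw [mk_prod, lift_id, lift_id, mk_set, mk_prod, lift_id, hprod, mul_eq_self hι]
    refine mul_le_of_le (hι.trans (cantor _).le) ?_ le_rfl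
    rw [← power_def]
    have h : #(Word (ULift.{u} ℕ)) ≤ ℵ₀ := mk_word_le le_rfl (by simp)
    refine (power_le_power_right h).trans ?_
    -- `ℵ₀ ^ μ ≤ (2 ^ ℵ₀) ^ μ = 2 ^ μ`, with `μ = #ι`.
    refine (power_le_power_right (cantor ℵ₀).le).trans ?_
    rw [← power_mul, aleph0_mul_eq hι]

/-! ### Cuts of a set of indices -/

open Classical in
/-- The least element of `S` not below `j`, if any. -/
noncomputable def upper (S : Set J) (j : J) : Option S :=
  if h : ∃ m, m ∈ S ∧ j ≤ m then
    some ⟨(exists_least h).choose, (exists_least h).choose_spec.1.1⟩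
  else none

theorem upper_eq_some {S : Set J} {j : J} {m : S} (h : upper S j = some m) :
    j ≤ m ∧ ∀ x ∈ S, j ≤ x → (m : J) ≤ x := by
  unfold upper at h
  split_ifs at h with h'
  rw [← Option.some_injective _ h]
  have := (exists_least h').choose_spec
  exact ⟨this.1.2, fun x hx hjx => this.2 x ⟨hx, hjx⟩⟩

theorem upper_eq_none {S : Set J} {j : J} (h : upper S j = none) : ∀ x ∈ S, x < j := by
  unfold upper at h
  split_ifs at h with h'
  exact fun x hx => not_le.1 fun hjx => h' ⟨x, hx, hjx⟩

theorem lt_of_upper_eq {S : Set J} {i j x : J} (h : upper S i = upper S j) (hx : x ∈ S)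
    (hxi : x < i) : x < j := by
  cases hj : upper S j with
  | none => exact upper_eq_none hj x hx
  | some m =>
    rw [hj] at h
    by_contra hjx
    have := (upper_eq_some hj).2 x hx (not_lt.1 hjx)
    exact absurd hxi ((upper_eq_some h).1.trans this).not_gt

/-- Here `j ∉ S` matters: an element `m` of `S` has the same `upper` as the indices of the cut just
below it. -/
theorem lt_of_upper_eq' {S : Set J} {i j x : J} (h : upper S i = upper S j) (hx : x ∈ S)
    (hj : j ∉ S) (hxi : i < x) : j < x :=
  lt_of_le_of_ne (not_lt.1 fun hxj => hxi.not_gt (lt_of_upper_eq h.symm hx hxj))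
    fun h' => hj (h' ▸ hx)

theorem exists_between_of_upper_ne {S : Set J} {i j : J} (hij : i < j)
    (hi : i ∉ S) (h : upper S i ≠ upper S j) : ∃ x ∈ S, i < x ∧ x < j := by
  cases hi' : upper S i with
  | none =>
    have := upper_eq_none hi'
    cases hj' : upper S j with
    | none => exact absurd (hi'.trans hj'.symm) h
    | some m => exact absurd (upper_eq_some hj').1 ((this m m.2).trans hij).not_ge
  | some m =>
    obtain ⟨h₁, h₂⟩ := upper_eq_some hi'
    refine ⟨m, m.2, lt_of_le_of_ne h₁ fun h => hi (h ▸ m.2), ?_⟩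
    by_contra hjm
    rw [not_lt] at hjm
    cases hj' : upper S j with
    | none => exact absurd (upper_eq_none hj' m m.2) hjm.not_gt
    | some m' =>
      obtain ⟨h₃, h₄⟩ := upper_eq_some hj'
      have : m = m' := Subtype.ext (le_antisymm (h₂ m' m'.2 (hij.le.trans h₃)) (h₄ m m.2 hjm))
      exact h (by rw [hi', hj', this])

/-! ### Orbits of finite sequences over a small set -/

open Classical in
/-- The type of an index over `S`, together with its rank in a set `F`. -/
noncomputable def code (S F : Set J) (j : J) : S ⊕ (Option S × ℕ) :=
  if h : j ∈ S then Sum.inl ⟨j, h⟩ else Sum.inr (upper S j, {f ∈ F | f < j}.ncard)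

/-- Comparisons with elements of `S` are decided by `upper`, those between two indices outside `S`
by the rank. The ranks are taken in different sets, but each is monotone in the index, and `j ∈ F`
makes the rank of `j'` strictly larger than that of `j`. -/
theorem lt_of_code_eq {S F F' : Set J} (hF : F.Finite) (hF' : F'.Finite) {j j' i i' : J}
    (hj : j ∈ S ∪ F) (h : code S F j = code S F' i) (h' : code S F j' = code S F' i')
    (hjj' : j < j') : i < i' := by
  unfold code at h h'
  split_ifs at h h' with h₁ h₂ h₃ h₄ h₃ h₄ h₃ h₄
  · simp only [Sum.inl.injEq, Subtype.mk.injEq] at h h'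
    rwa [← h, ← h']
  · simp only [Sum.inl.injEq, Subtype.mk.injEq, Sum.inr.injEq, Prod.mk.injEq] at h h'
    rw [← h]
    exact lt_of_upper_eq h'.1 h₁ hjj'
  · simp only [Sum.inl.injEq, Subtype.mk.injEq, Sum.inr.injEq, Prod.mk.injEq] at h h'
    rw [← h']
    exact lt_of_upper_eq' h.1 (by assumption) (by assumption) hjj'
  · simp only [Sum.inr.injEq, Prod.mk.injEq] at h h'
    by_contra hii
    have hsub : {f ∈ F' | f < i'} ⊆ {f ∈ F' | f < i} := fun f hf =>
      ⟨hf.1, hf.2.trans_le (not_lt.1 hii)⟩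
    have h₁' := Set.ncard_le_ncard hsub (hF'.subset fun f hf => hf.1)
    have hss : {f ∈ F | f < j} ⊂ {f ∈ F | f < j'} := by
      refine ⟨fun f hf => ⟨hf.1, hf.2.trans hjj'⟩, fun hc => ?_⟩
      exact lt_irrefl _ (hc (⟨hj.resolve_left h₁, hjj'⟩ : j ∈ {f ∈ F | f < j'})).2
    have h₂' := Set.ncard_lt_ncard hss (hF.subset fun f hf => hf.1)
    omega

/-- The invariant replaces each letter by its code. Equal codes give order-isomorphic families that
agree on `S`, so the automorphism fixes all words over `S`, in particular those in `A`. -/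
theorem mk_quotient_autSetoid_fin [Nonempty J] [NoMaxOrder J]
    (hJ : ∀ b : J, Nonempty (Set.Ici b ≃o J)) {θ : Cardinal.{u}}
    (hθ : ℵ₀ < θ) (hb : ∀ T : Set J, #T < θ → ∃ b, ∀ x ∈ T, x < b) (A : Set (Word J)) (hA : #A < θ)
    (n : ℕ) : #(Quotient (autSetoid A (Fin n))) ≤ max ℵ₀ #A := by
  obtain ⟨d⟩ := ‹Nonempty J›
  -- Putting the default letter `d` into `S` gives it the same code for all sequences.
  set S : Set J := (⋃ x : A, x.1.letters) ∪ {d} with hS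
  have hSA : #S ≤ max ℵ₀ #A := (mk_union_le _ _).trans (add_le_of_le (le_max_left _ _)
    (mk_iUnion_letters_le _ (le_max_left _ _) (le_max_right _ _))
    ((mk_singleton d).le.trans (one_le_aleph0.trans (le_max_left _ _))))
  have hd : d ∈ S := Or.inr rfl
  let F : (Fin n → Word J) → Set J := fun s => ⋃ i, (s i).letters
  have hF : ∀ s, (F s).Finite := fun s => Set.finite_iUnion fun i => (s i).letters_finite
  let p : (Fin n → Word J) → S ⊕ (Fin n × ℕ) → J := fun s =>
    Sum.elim Subtype.val fun k => (s k.1).letterAt d k.2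
  have hpmem : ∀ s k, p s k ∈ S ∪ F s := by
    rintro s (k | k)
    · exact Or.inl k.2
    · rcases Word.letterAt_mem d (s k.1) k.2 with h | h
      · left
        change (s k.1).letterAt d k.2 ∈ S
        rw [h]
        exact hd
      · exact Or.inr (Set.mem_iUnion.2 ⟨k.1, h⟩)
  have hp : ∀ (s : Fin n → Word J) i,
      ((s i).skeleton.map fun m => (Sum.inr (i, m) : S ⊕ (Fin n × ℕ))).map (p s) = s i := by
    intro s i
    rw [Word.map_map]
    exact Word.map_skeleton d (s i)
  refine (mk_quotient_le (β := Fin n → Word (S ⊕ (Option S × ℕ))) _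
    (fun s i => (s i).map (code S (F s))) ?_).trans ?_
  · intro s t h
    have h₁ : ∀ i, (s i).skeleton = (t i).skeleton := fun i => by
      rw [← Word.skeleton_map (code S (F s)), ← Word.skeleton_map (code S (F t))]
      exact congrArg Word.skeleton (congrFun h i)
    have hcd : ∀ F' : Set J, code S F' d = Sum.inl ⟨d, hd⟩ := fun F' => dif_pos hd
    have h₂ : ∀ k, code S (F s) (p s k) = code S (F t) (p t k) := by
      rintro (k | k)
      · have hk : ∀ F' : Set J, code S F' k = Sum.inl k := fun F' => dif_pos k.2
        exact (hk _).trans (hk _).symm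
      · change code S (F s) ((s k.1).letterAt d k.2) = code S (F t) ((t k.1).letterAt d k.2)
        rw [← Word.letterAt_map (code S (F s)), ← Word.letterAt_map (code S (F t)), hcd, hcd]
        exact congrArg (fun w => Word.letterAt _ w k.2) (congrFun h k.1)
    have hST : #(S ∪ F s ∪ F t : Set J) < θ := by
      have hfin : ∀ r, #(F r) ≤ max ℵ₀ #A := fun r =>
        ((hF r).countable.le_aleph0).trans (le_max_left _ _)
      refine lt_of_le_of_lt ?_ (max_lt hθ hA)
      refine (mk_union_le _ _).trans (add_le_of_le (le_max_left _ _) ?_ (hfin t))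
      exact (mk_union_le _ _).trans (add_le_of_le (le_max_left _ _) hSA (hfin s))
    obtain ⟨b, hb⟩ := hb _ hST
    obtain ⟨G, hG⟩ := exists_orderIso_map hJ (p := p s) (q := p t) (b := b)
      (fun k => hb _ (Or.inl (hpmem s k)))
      (fun k => hb _ ((hpmem t k).imp (fun h => Or.inl h) id)) (fun k k' => by
        rw [← not_lt, ← not_lt, not_iff_not]
        exact ⟨lt_of_code_eq (hF s) (hF t) (hpmem s k') (h₂ k') (h₂ k),
          lt_of_code_eq (hF t) (hF s) (hpmem t k') (h₂ k').symm (h₂ k).symm⟩)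
    refine ⟨G, fun x hx => ?_, fun i => ?_⟩
    · obtain ⟨w, hw⟩ := Word.exists_map (p := (Subtype.val : S → J)) (w := x) fun i hi =>
        ⟨⟨i, Or.inl (Set.mem_iUnion.2 ⟨⟨x, hx⟩, hi⟩)⟩, rfl⟩
      have := hG (w.map Sum.inl)
      rw [Word.map_map, Word.map_map] at this
      rw [← hw]
      exact this
    · conv_lhs => rw [← hp s i]
      rw [hG, h₁, hp]
  · set c := max ℵ₀ #A with hc
    have hc₀ : ℵ₀ ≤ c := le_max_left _ _
    have hO : #(Option S × ℕ) ≤ c := by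
      rw [mk_prod, lift_uzero, mk_nat, lift_aleph0, mk_option]
      exact mul_le_of_le hc₀ (add_le_of_le hc₀ hSA (one_le_aleph0.trans hc₀)) hc₀
    have hC : #(S ⊕ (Option S × ℕ)) ≤ c := by
      rw [mk_sum, lift_id, lift_id]
      exact add_le_of_le hc₀ hSA hO
    have := mk_word_le hc₀ hC
    rw [mk_arrow, lift_uzero, mk_fin, lift_natCast, power_natCast]
    exact (pow_le_pow_left' this n).trans (power_nat_le hc₀)

/-! ### Moving small sets into a fixed set -/

/-- Otherwise some `x` would have order type `μ⁺` below it. -/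
theorem mk_le_succ_of_Iio {μ : Cardinal.{u}} (h : ∀ x : J, #(Set.Iio x) ≤ μ) :
    #J ≤ Order.succ μ := by
  by_contra hlt
  rw [not_le] at hlt
  have h₁ : (Order.succ μ).ord < Ordinal.type (α := J) (· < ·) :=
    (ord_lt_ord.2 hlt).trans_le (ord_le_type _)
  obtain ⟨x, hx⟩ := Ordinal.typein_surj (α := J) (· < ·) h₁
  have h₂ := congrArg Ordinal.card hx
  rw [card_ord] at h₂
  exact (Order.lt_succ μ).not_ge (h₂ ▸ h x)

/-- The Mostowski collapse: everything below a value is again a value. -/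
theorem exists_strictMono_initial {X Y : Type u} [LinearOrder X] [LinearOrder Y] [WellFoundedLT Y]
    (i : X ↪o Y) : ∃ f : X → Y, StrictMono f ∧ ∀ x, #(Set.Iio (f x)) ≤ #X := by
  let f : InitialSeg (α := X) (β := Y) (· < ·) (· < ·) := i.ltEmbedding.collapse
  refine ⟨f, fun x y h => f.map_rel_iff.2 h, fun x => ?_⟩
  refine (mk_le_mk_of_subset (t := Set.range f) fun y hy => ?_).trans mk_range_le
  exact f.mem_range_of_rel hy

theorem exists_absorbing_set [Nonempty J] [NoMaxOrder J] (hJ : ∀ b : J, Nonempty (Set.Ici b ≃o J))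
    {μ θ : Cardinal.{u}} (hμ : ℵ₀ ≤ μ) (hθ : μ < θ)
    (hb : ∀ T : Set J, #T < θ → ∃ b, ∀ x ∈ T, x < b) (A : Set (Word J)) (hA : #A < θ) :
    ∃ B : Set (Word J), #B ≤ Order.succ μ + #A ∧ ∀ Z : Set (Word J), #Z ≤ μ →
      ∃ h : Word J ≃o Word J, (∀ x ∈ A, h x = x) ∧ ∀ x ∈ Z, h x ∈ B := by
  set S : Set J := ⋃ x : A, x.1.letters with hS
  set c : Cardinal.{u} := Order.succ μ + #A with hc
  have hμc : Order.succ μ ≤ c := self_le_add_right _ _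
  have hc₀ : ℵ₀ ≤ c := hμ.trans ((Order.le_succ μ).trans hμc)
  have hSc : #S ≤ c := mk_iUnion_letters_le _ hc₀ (self_le_add_left _ _)
  -- `D z` is a cut of `S`, and `T₀ z` consists of its members with at most `μ` predecessors inside
  -- it. The absorbing set is formed by all words over `T`.
  let D : Option S → Set J := fun z => {i | i ∉ S ∧ upper S i = z}
  let T₀ : Option S → Set J := fun z => {i | i ∈ D z ∧ #{j | j ∈ D z ∧ j < i} ≤ μ}
  set T : Set J := S ∪ ⋃ z, T₀ z with hT
  have hT₀ : ∀ z, #(T₀ z) ≤ Order.succ μ := by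
    intro z
    refine mk_le_succ_of_Iio fun x => le_trans ?_ x.2.2
    refine mk_le_of_injective (f := fun y => ⟨y.1.1, y.1.2.1, y.2⟩) ?_
    intro y y' h
    exact Subtype.ext (Subtype.ext (congrArg (fun z => z.1) h))
  have hTc : #T ≤ c := by
    refine (mk_union_le _ _).trans (add_le_of_le hc₀ hSc ?_)
    refine mk_iUnion_le_sum_mk.trans ((sum_le_mk_mul_iSup _).trans ?_)
    refine mul_le_of_le hc₀ ?_ (ciSup_le' fun z => (hT₀ z).trans hμc)
    rw [mk_option]
    exact add_le_of_le hc₀ hSc (one_le_aleph0.trans hc₀)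
  refine ⟨Set.range (Word.map (Subtype.val : T → J)), mk_range_le.trans (mk_word_le hc₀ hTc), ?_⟩
  intro Z hZ
  set F : Set J := ⋃ x : Z, x.1.letters with hF
  have hFμ : #F ≤ μ := mk_iUnion_letters_le _ hμ hZ
  have hf : ∀ z, ∃ f : (F ∩ D z : Set J) → D z, StrictMono f ∧ ∀ x, #(Set.Iio (f x)) ≤ μ := by
    intro z
    obtain ⟨f, hf, hf'⟩ := exists_strictMono_initial
      (Subtype.orderEmbedding (α := J) (p := (· ∈ F ∩ D z)) (q := (· ∈ D z)) fun _ h => h.2)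
    exact ⟨f, hf, fun x => (hf' x).trans ((mk_le_mk_of_subset Set.inter_subset_left).trans hFμ)⟩
  choose f hf hf' using hf
  let p : (S ∪ F : Set J) → J := Subtype.val
  classical
  -- Fix `S` and collapse the letters of `Z` within each cut of `S`.
  let q : (S ∪ F : Set J) → J := fun k => if h : k.1 ∈ S then k.1 else
    (f (upper S k.1) ⟨k.1, k.2.resolve_left h, h, rfl⟩).1
  have hqS : ∀ k (_ : k.1 ∈ S), q k = k.1 := fun k h => dif_pos h
  have hqF : ∀ k (h : k.1 ∉ S), q k = (f (upper S k.1) ⟨k.1, k.2.resolve_left h, h, rfl⟩).1 :=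
    fun k h => dif_neg h
  have hqD : ∀ k (_ : k.1 ∉ S), q k ∈ D (upper S k.1) := fun k h => by
    rw [hqF k h]
    exact Subtype.prop _
  have hqT : ∀ k, q k ∈ T := by
    intro k
    by_cases h : k.1 ∈ S
    · rw [hqS k h]
      exact Or.inl h
    · refine Or.inr (Set.mem_iUnion.2 ⟨upper S k.1, hqD k h, ?_⟩)
      refine le_trans ?_ (hf' (upper S k.1) ⟨k.1, k.2.resolve_left h, h, rfl⟩)
      refine mk_le_of_injective (f := fun y => ⟨⟨y.1, y.2.1⟩, ?_⟩) ?_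
      · exact y.2.2.trans_eq (hqF k h)
      · intro y y' h
        exact Subtype.ext (congrArg (fun z => z.1.1) h)
  have hq : StrictMono q := by
    intro k k' hkk'
    have hkk : k.1 < k'.1 := hkk'
    by_cases h : k.1 ∈ S <;> by_cases h' : k'.1 ∈ S
    · rwa [hqS k h, hqS k' h']
    · rw [hqS k h]
      exact lt_of_upper_eq (hqD k' h').2.symm h hkk
    · rw [hqS k' h']
      exact lt_of_upper_eq' (hqD k h).2.symm h' (hqD k h).1 hkk
    · by_cases hu : upper S k.1 = upper S k'.1
      · rw [hqF k h, hqF k' h']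
        have aux : ∀ z (hz : upper S k'.1 = z),
            (f (upper S k'.1) ⟨k'.1, k'.2.resolve_left h', h', rfl⟩).1 =
              (f z ⟨k'.1, k'.2.resolve_left h', h', hz⟩).1 := by
          rintro _ rfl
          rfl
        rw [aux _ hu.symm]
        exact hf _ hkk
      · obtain ⟨x, hx, h₁, h₂⟩ := exists_between_of_upper_ne hkk h hu
        exact (lt_of_upper_eq' (hqD k h).2.symm hx (hqD k h).1 h₁).trans
          (lt_of_upper_eq (hqD k' h').2.symm hx h₂)
  have hSF : #(S ∪ F : Set J) < θ := by
    refine (mk_union_le _ _).trans_lt (add_lt_of_lt (hμ.trans hθ.le) ?_ (hFμ.trans_lt hθ))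
    exact mk_iUnion_letters_lt A (hμ.trans_lt hθ) hA
  obtain ⟨b₁, hb₁⟩ := hb _ hSF
  obtain ⟨b₂, hb₂⟩ := hb (Set.range q) (mk_range_le.trans_lt hSF)
  obtain ⟨G, hG⟩ := exists_orderIso_map hJ (p := p) (q := q) (b := max b₁ b₂)
    (fun k => (hb₁ k k.2).trans_le (le_max_left _ _))
    (fun k => (hb₂ _ ⟨k, rfl⟩).trans_le (le_max_right _ _)) (fun k k' => hq.le_iff_le.symm)
  refine ⟨G, fun x hx => ?_, fun x hx => ?_⟩
  · obtain ⟨w, rfl⟩ := Word.exists_map (p := (Subtype.val : S → J)) (w := x) fun i hi =>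
      ⟨⟨i, Set.mem_iUnion.2 ⟨⟨x, hx⟩, hi⟩⟩, rfl⟩
    have := hG (w.map (Set.inclusion Set.subset_union_left))
    rw [Word.map_map, Word.map_map] at this
    have hqi : q ∘ Set.inclusion Set.subset_union_left = (Subtype.val : S → J) :=
      funext fun k => hqS _ k.2
    rw [hqi] at this
    exact this
  · obtain ⟨w, rfl⟩ := Word.exists_map (p := p) (w := x) fun i hi =>
      ⟨⟨i, Or.inr (Set.mem_iUnion.2 ⟨⟨x, hx⟩, hi⟩)⟩, rfl⟩
    refine ⟨w.map fun k => ⟨q k, hqT k⟩, ?_⟩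
    rw [hG, Word.map_map]
    rfl

end

/-! ### Quantifier-free types determine generated structures -/

section
open FirstOrder.Language

variable {L : FirstOrder.Language.{0, 0}} {K : Type u}

theorem exists_term_relabel {J : Type v} [DecidableEq K] {t : J → K} (τ : L.Term K)
    (h : ∀ k ∈ τ.varFinset, ∃ j, t j = k) : ∃ τ' : L.Term J, τ'.relabel t = τ := by
  induction τ with
  | var k =>
    obtain ⟨j, rfl⟩ := h k (by simp [Term.varFinset])
    exact ⟨Term.var j, rfl⟩
  | func f ts ih =>
    choose τ' hτ' using fun i => ih i fun k hk => h k (by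
      simp only [Term.varFinset, Finset.mem_biUnion, Finset.mem_univ, true_and]
      exact ⟨i, hk⟩)
    exact ⟨Term.func f τ', by simp only [Term.relabel, hτ']⟩

theorem exists_terms_relabel {m : ℕ} (τ : Fin m → L.Term K) :
    ∃ (n : ℕ) (t : Fin n → K) (τ' : Fin m → L.Term (Fin n)), ∀ i, (τ' i).relabel t = τ i := by
  classical
  let s : Finset K := Finset.univ.biUnion fun i => (τ i).varFinset
  have h : ∀ i, ∃ τ' : L.Term (Fin s.card), τ'.relabel (fun j => (s.equivFin.symm j : K)) = τ i := by
    intro i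
    refine exists_term_relabel _ fun k hk => ?_
    have hks : k ∈ s := Finset.mem_biUnion.2 ⟨i, Finset.mem_univ i, hk⟩
    exact ⟨s.equivFin ⟨k, hks⟩, by simp⟩
  choose τ' hτ' using h
  exact ⟨_, _, τ', hτ'⟩

variable {M N : Type*} [L.Structure M] [L.Structure N]

/-- Finitely many terms use finitely many variables, so the comparison takes place inside the type
of a finite tuple. -/
theorem relMap_realize_iff {a : K → M} {b : K → N}
    (h : ∀ (n : ℕ) (t : Fin n → K), qfType L (fun i => a (t i)) = qfType L (fun i => b (t i)))
    {m : ℕ} (r : L.Relations m) (τ : Fin m → L.Term K) :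
    Structure.RelMap r (fun i => (τ i).realize a) ↔ Structure.RelMap r (fun i => (τ i).realize b) := by
  obtain ⟨n, t, τ', hτ'⟩ := exists_terms_relabel τ
  have hφ : (r.formula τ').IsQF := (BoundedFormula.IsAtomic.rel _ _).isQF
  have := Set.ext_iff.1 (h n t) (r.formula τ')
  simp only [qfType, Set.mem_ofPred_eq, hφ, true_and, Formula.realize_rel] at this
  simpa only [← hτ', Term.realize_relabel, Function.comp_def] using this

theorem realize_eq_iff {a : K → M} {b : K → N}
    (h : ∀ (n : ℕ) (t : Fin n → K), qfType L (fun i => a (t i)) = qfType L (fun i => b (t i)))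
    (τ σ : L.Term K) : τ.realize a = σ.realize a ↔ τ.realize b = σ.realize b := by
  obtain ⟨n, t, τ', hτ'⟩ := exists_terms_relabel ![τ, σ]
  have hφ : ((τ' 0).equal (τ' 1)).IsQF := (BoundedFormula.IsAtomic.equal _ _).isQF
  have := Set.ext_iff.1 (h n t) ((τ' 0).equal (τ' 1))
  simp only [qfType, Set.mem_ofPred_eq, hφ, true_and, Formula.realize_equal] at this
  have h₀ := hτ' 0
  have h₁ := hτ' 1
  simp only [Matrix.cons_val_zero, Matrix.cons_val_one] at h₀ h₁
  simpa only [← h₀, ← h₁, Term.realize_relabel, Function.comp_def] using this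

/-- Structures generated by families with the same quantifier-free types are isomorphic. -/
theorem exists_equiv_of_qfType_eq {a : K → M} {b : K → N}
    (h : ∀ (n : ℕ) (t : Fin n → K), qfType L (fun i => a (t i)) = qfType L (fun i => b (t i)))
    {A : L.Substructure M} {B : L.Substructure N}
    (hA : ∀ x, x ∈ A ↔ ∃ τ : L.Term K, τ.realize a = x)
    (hB : ∀ x, x ∈ B ↔ ∃ τ : L.Term K, τ.realize b = x) :
    ∃ Φ : A ≃[L] B, ∀ (x : A) (τ : L.Term K), τ.realize a = x → (Φ x : N) = τ.realize b := by
  -- Each element is named by a term. By `realize_eq_iff` the image does not depend on the chosen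
  -- name.
  choose c hc using fun x : A => (hA x).1 x.2
  choose d hd using fun x : B => (hB x).1 x.2
  have hcb : ∀ (x : A) (τ : L.Term K), τ.realize a = x → (c x).realize b = τ.realize b :=
    fun x τ hτ => (realize_eq_iff h _ _).1 ((hc x).trans hτ.symm)
  have hda : ∀ (x : B) (τ : L.Term K), τ.realize b = x → (d x).realize a = τ.realize a :=
    fun x τ hτ => (realize_eq_iff h _ _).2 ((hd x).trans hτ.symm)
  refine ⟨{ toFun := fun x => ⟨(c x).realize b, (hB _).2 ⟨_, rfl⟩⟩
            invFun := fun x => ⟨(d x).realize a, (hA _).2 ⟨_, rfl⟩⟩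
            left_inv := fun x => Subtype.ext ((hda _ _ rfl).trans (hc x))
            right_inv := fun x => Subtype.ext ((hcb _ _ rfl).trans (hd x))
            map_fun' := fun {n} f x => Subtype.ext ?_
            map_rel' := fun {n} r x => ?_ }, fun x τ hτ => hcb x τ hτ⟩
  · refine hcb _ (Term.func f fun i => c (x i)) ?_
    rw [Term.realize_func]
    simp only [hc]
    rfl
  · have := relMap_realize_iff h r fun i => c (x i)
    simp only [hc] at this
    exact this.symm

theorem qfType_embedding (g : M ↪[L] N) {n : ℕ} (x : Fin n → M) :
    qfType L (fun i => g (x i)) = qfType L x := by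
  ext φ
  refine and_congr_right fun hφ => ?_
  have := hφ.realize_embedding g (v := x) (xs := default)
  rwa [Subsingleton.elim (g ∘ default) default] at this

theorem mem_closure_range_iff {a : K → M} {x : M} :
    x ∈ Substructure.closure L (Set.range a) ↔ ∃ τ : L.Term K, τ.realize a = x := by
  constructor
  · intro hx
    refine Substructure.closure_induction (p := fun x => ∃ τ : L.Term K, τ.realize a = x) hx ?_ ?_
    · rintro _ ⟨k, rfl⟩
      exact ⟨Term.var k, rfl⟩
    · intro n f y hy
      choose τ hτ using hy
      exact ⟨Term.func f τ, by simp only [Term.realize_func, hτ]⟩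
  · rintro ⟨τ, rfl⟩
    exact Term.realize_mem _ _ fun k => Substructure.subset_closure ⟨k, rfl⟩

end

/-! ### The template -/

/-- The function symbols of the language of words: the empty word, change of signs, concatenation. -/
inductive WordFun : ℕ → Type
  | one : WordFun 0
  | neg : WordFun 1
  | mul : WordFun 2

/-- The language of words. -/
def wordLang : FirstOrder.Language.{0, 0} := ⟨WordFun, TauRel⟩

/-- Concatenation of words. -/
def Word.append {J : Type u} (x y : Word J) : Word J := List.append x y

theorem Word.map_append {K : Type v} {J : Type u} (p : K → J) (x y : Word K) :
    (x.append y).map p = (x.map p).append (y.map p) := List.map_append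

theorem Word.map_flip {K : Type v} {J : Type u} (p : K → J) (x : Word K) :
    x.flip.map p = (x.map p).flip := by
  induction x using Word.ind with
  | nil => rfl
  | cons a x ih => rw [Word.flip_cons, Word.map_cons, ih, Word.map_cons, Word.flip_cons]

/-- The first letter of a word, if any, has an index in `Q`. -/
def Word.headIn {J : Type u} (Q : J → Prop) (e : Prop) : Word J → Prop
  | [] => e
  | a :: _ => Q a.2

instance wordStructure (J : Type u) [tau.Structure J] : wordLang.Structure (Word J) where
  funMap := fun f => match f with
    | WordFun.one => fun _ => Word.nil
    | WordFun.neg => fun x => (x 0).flip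
    | WordFun.mul => fun x => (x 0).append (x 1)
  RelMap := fun r => match r with
    | TauRel.lt => fun x => wordLT tauLT (x 0) (x 1)
    | TauRel.P0 => fun x => (x 0).headIn tauP0 True
    | TauRel.P1 => fun x => (x 0).headIn tauP1 False

/-- The word consisting of one positive letter. -/
def Word.of {J : Type u} (t : J) : Word J := Word.cons (true, t) Word.nil

/-- The value of a term at the one-letter words. -/
def wordEval {K : Type u} : wordLang.Term K → Word K
  | Language.Term.var k => Word.of k
  | Language.Term.func f ts => match f, ts with
    | WordFun.one, _ => Word.nil
    | WordFun.neg, ts => (wordEval (ts 0)).flip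
    | WordFun.mul, ts => (wordEval (ts 0)).append (wordEval (ts 1))

/-- The operations commute with renaming of letters, so a term has one value as a word over its
variables, independent of `J`. -/
theorem realize_word {K : Type v} {J : Type u} [tau.Structure J] (p : K → J)
    (τ : wordLang.Term K) : τ.realize (fun k => Word.of (p k)) = (wordEval τ).map p := by
  induction τ with
  | var k => rfl
  | func f ts ih =>
    rw [Language.Term.realize_func]
    cases f with
    | one => rfl
    | neg =>
      change Word.flip ((ts 0).realize fun k => Word.of (p k)) = (wordEval (ts 0)).flip.map p
      rw [ih, Word.map_flip]
    | mul =>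
      change Word.append ((ts 0).realize fun k => Word.of (p k))
        ((ts 1).realize fun k => Word.of (p k)) =
        ((wordEval (ts 0)).append (wordEval (ts 1))).map p
      rw [ih, ih, Word.map_append]

/-- Two families in `{<, P₀, P₁}`-structures satisfy the same atomic formulas. -/
structure SameAtomic {K : Type v} {J J' : Type u} [tau.Structure J] [tau.Structure J']
    (p : K → J) (p' : K → J') : Prop where
  eq : ∀ i j, p i = p j ↔ p' i = p' j
  lt : ∀ i j, tauLT (p i) (p j) ↔ tauLT (p' i) (p' j)
  P0 : ∀ i, tauP0 (p i) ↔ tauP0 (p' i)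
  P1 : ∀ i, tauP1 (p i) ↔ tauP1 (p' i)

section
variable {K : Type v} {J J' : Type u} [tau.Structure J] [tau.Structure J'] {p : K → J} {p' : K → J'}

theorem SameAtomic.map_eq (h : SameAtomic p p') (x y : Word K) :
    x.map p = y.map p ↔ x.map p' = y.map p' := by
  induction x using Word.ind generalizing y with
  | nil =>
    induction y using Word.ind with
    | nil => simp
    | cons b y => exact iff_of_false (Word.cons_ne_nil _ _).symm (Word.cons_ne_nil _ _).symm
  | cons a x ih =>
    induction y using Word.ind with
    | nil => exact iff_of_false (Word.cons_ne_nil _ _) (Word.cons_ne_nil _ _)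
    | cons b y =>
      simp only [Word.map_cons, Word.cons_inj, ih, Prod.mk.injEq, h.eq]

theorem SameAtomic.map_lt (h : SameAtomic p p') (x y : Word K) :
    wordLT tauLT (x.map p) (y.map p) ↔ wordLT tauLT (x.map p') (y.map p') := by
  induction x using Word.ind generalizing y with
  | nil =>
    induction y using Word.ind with
    | nil => exact Iff.rfl
    | cons b y => exact Iff.rfl
  | cons a x ih =>
    induction y using Word.ind with
    | nil => exact Iff.rfl
    | cons b y =>
      change (letterLT tauLT (a.1, p a.2) (b.1, p b.2) ∨ (_ ∧ wordLT tauLT (x.map p) (y.map p))) ↔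
        (letterLT tauLT (a.1, p' a.2) (b.1, p' b.2) ∨ (_ ∧ wordLT tauLT (x.map p') (y.map p')))
      rw [ih, Prod.mk.injEq, Prod.mk.injEq, h.eq]
      obtain ⟨_ | _, i⟩ := a <;> obtain ⟨_ | _, j⟩ := b <;> simp [letterLT, h.lt]

theorem SameAtomic.relMap (h : SameAtomic p p') {n : ℕ} (r : wordLang.Relations n)
    (x : Fin n → Word K) :
    Language.Structure.RelMap r (fun i => (x i).map p) ↔
      Language.Structure.RelMap r (fun i => (x i).map p') := by
  cases r with
  | lt => exact h.map_lt (x 0) (x 1)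
  | P0 =>
    change ((x 0).map p).headIn tauP0 True ↔ ((x 0).map p').headIn tauP0 True
    induction x 0 using Word.ind with
    | nil => exact Iff.rfl
    | cons a x => exact h.P0 a.2
  | P1 =>
    change ((x 0).map p).headIn tauP1 False ↔ ((x 0).map p').headIn tauP1 False
    induction x 0 using Word.ind with
    | nil => exact Iff.rfl
    | cons a x => exact h.P1 a.2

end

/-! ### Types of letters determine types of words -/

section
variable {J J' : Type u} [tau.Structure J] [tau.Structure J'] {n : ℕ} {t : Fin n → J}
  {t' : Fin n → J'}

theorem sameAtomic_of_qfType_eq (h : qfType tau t = qfType tau t') : SameAtomic t t' := by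
  have hφ : ∀ φ : tau.Formula (Fin n), Language.BoundedFormula.IsAtomic φ →
      (φ.Realize t ↔ φ.Realize t') := by
    intro φ hφ
    have := Set.ext_iff.1 h φ
    simpa only [qfType, Set.mem_ofPred_eq, hφ.isQF, true_and] using this
  have h₁ : ∀ {M : Type u} [tau.Structure M] (s : Fin n → M) i,
      (fun k => (![Language.Term.var i] k : tau.Term (Fin n)).realize s) = ![s i] := by
    intro M _ s i
    funext k
    fin_cases k
    rfl
  have h₂ : ∀ {M : Type u} [tau.Structure M] (s : Fin n → M) i j,
      (fun k => (![Language.Term.var i, Language.Term.var j] k : tau.Term (Fin n)).realize s) =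
        ![s i, s j] := by
    intro M _ s i j
    funext k
    fin_cases k <;> rfl
  have hrel : ∀ {m : ℕ} (r : tau.Relations m) (ts : Fin m → tau.Term (Fin n)),
      Language.Structure.RelMap r (fun k => (ts k).realize t) ↔
        Language.Structure.RelMap r (fun k => (ts k).realize t') := by
    intro m r ts
    have := hφ (r.formula ts) (Language.BoundedFormula.IsAtomic.rel _ _)
    rwa [Language.Formula.realize_rel, Language.Formula.realize_rel] at this
  refine ⟨fun i j => ?_, fun i j => ?_, fun i => ?_, fun i => ?_⟩
  · have := hφ ((Language.Term.var i).equal (Language.Term.var j))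
      (Language.BoundedFormula.IsAtomic.equal _ _)
    rwa [Language.Formula.realize_equal, Language.Formula.realize_equal] at this
  · have := hrel TauRel.lt ![Language.Term.var i, Language.Term.var j]
    rwa [h₂, h₂] at this
  · have := hrel TauRel.P0 ![Language.Term.var i]
    rwa [h₁, h₁] at this
  · have := hrel TauRel.P1 ![Language.Term.var i]
    rwa [h₁, h₁] at this

theorem SameAtomic.realize_iff (h : SameAtomic t t') {φ : wordLang.Formula (Fin n)}
    (hφ : Language.BoundedFormula.IsQF φ) :
    φ.Realize (fun i => Word.of (t i)) ↔ φ.Realize (fun i => Word.of (t' i)) := by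
  have h' : SameAtomic (Sum.elim t (Fin.elim0 : Fin 0 → J)) (Sum.elim t' (Fin.elim0 : Fin 0 → J')) := by
    refine ⟨?_, ?_, ?_, ?_⟩
    · rintro (i | i) (j | j)
      exacts [h.eq i j, j.elim0, i.elim0, i.elim0]
    · rintro (i | i) (j | j)
      exacts [h.lt i j, j.elim0, i.elim0, i.elim0]
    · rintro (i | i)
      exacts [h.P0 i, i.elim0]
    · rintro (i | i)
      exacts [h.P1 i, i.elim0]
  have he : ∀ {M : Type u} [tau.Structure M] (s : Fin n → M) (xs : Fin 0 → Word M),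
      Sum.elim (fun i => Word.of (s i)) xs =
        fun k => Word.of (Sum.elim s (Fin.elim0 : Fin 0 → M) k) := by
    intro M _ s xs
    funext k
    rcases k with k | k
    · rfl
    · exact k.elim0
  unfold Language.Formula.Realize
  induction hφ with
  | falsum => exact Iff.rfl
  | of_isAtomic hφ =>
    cases hφ with
    | equal τ σ =>
      rw [Language.BoundedFormula.realize_bdEqual, Language.BoundedFormula.realize_bdEqual, he, he,
        realize_word, realize_word, realize_word, realize_word]
      exact h'.map_eq _ _
    | rel r τ =>
      rw [Language.BoundedFormula.realize_rel, Language.BoundedFormula.realize_rel]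
      simp only [he, realize_word]
      exact h'.relMap _ _
  | imp _ _ ih₁ ih₂ =>
    rw [Language.BoundedFormula.realize_imp, Language.BoundedFormula.realize_imp]
    exact imp_congr ih₁ ih₂

/-- This makes the type assigned by `wordTemplate` independent of the realization from which it is
read off. -/
theorem qfType_word_eq (h : qfType tau t = qfType tau t') :
    qfType wordLang (fun i => Word.of (t i)) = qfType wordLang (fun i => Word.of (t' i)) := by
  ext φ
  exact and_congr_right fun hφ => (sameAtomic_of_qfType_eq h).realize_iff hφ

end

/-- The template of the structures of words. -/
def wordTemplate : Template where
  L := wordLang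
  emb := { onFunction := fun _ f => Empty.elim f, onRelation := fun _ r => r }
  typ n P := {φ | ∃ (J : Type u) (_ : tau.Structure J) (t : Fin n → J), qfType tau t = P ∧
    φ ∈ qfType wordLang (fun i => Word.of (t i))}

instance (J : Type u) [tau.Structure J] : wordTemplate.{u}.L.Structure (Word J) := wordStructure J

theorem closure_range_of (J : Type u) [tau.Structure J] :
    Language.Substructure.closure wordLang (Set.range (Word.of (J := J))) = ⊤ := by
  rw [eq_top_iff]
  intro w hw
  clear hw
  set C := Language.Substructure.closure wordLang (Set.range (Word.of (J := J)))
  have hof : ∀ t, Word.of t ∈ C := fun t => Language.Substructure.subset_closure ⟨t, rfl⟩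
  induction w using Word.ind with
  | nil => exact C.fun_mem WordFun.one ![] (fun i => i.elim0)
  | cons a w ih =>
    have hmul : ∀ x ∈ C, ∀ y ∈ C, Word.append x y ∈ C := fun x hx y hy =>
      C.fun_mem WordFun.mul ![x, y] (fun i => by fin_cases i <;> assumption)
    obtain ⟨_ | _, t⟩ := a
    · exact hmul (Word.of t).flip (C.fun_mem WordFun.neg ![Word.of t]
        (fun i => by fin_cases i; exact hof t)) w ih
    · exact hmul (Word.of t) (hof t) w ih

theorem isEM_word (J : Type u) [tau.Structure J] :
    IsEM wordTemplate.{u} (Word.of (J := J)) where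
  injective := fun s t h => by
    have := (Word.cons_inj.1 h).1
    exact congrArg Prod.snd this
  generates := closure_range_of J
  qfType_eq := fun n t => by
    ext φ
    constructor
    · exact fun h => ⟨J, inferInstance, t, rfl, h⟩
    · rintro ⟨J', _, t', h, hφ⟩
      exact (qfType_word_eq h) ▸ hφ

theorem exists_equiv_word {J M : Type u} [tau.Structure J] [wordTemplate.{u}.L.Structure M]
    {a : J → M} (ha : IsEM wordTemplate.{u} a) :
    ∃ Φ : M ≃[wordTemplate.{u}.L] Word J, ∀ τ : wordTemplate.{u}.L.Term J,
      Φ (τ.realize a) = τ.realize Word.of := by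
  have h : ∀ (n : ℕ) (t : Fin n → J), qfType wordTemplate.{u}.L (fun i => a (t i)) =
      qfType wordTemplate.{u}.L (fun i => Word.of (t i)) := fun n t =>
    (ha.qfType_eq n t).trans ((isEM_word J).qfType_eq n t).symm
  obtain ⟨Φ, hΦ⟩ := exists_equiv_of_qfType_eq h (A := ⊤) (B := ⊤)
    (fun x => by rw [← ha.generates]; exact mem_closure_range_iff)
    (fun x => by rw [← (isEM_word J).generates]; exact mem_closure_range_iff)
  refine ⟨(Language.Substructure.topEquiv.comp Φ).comp Language.Substructure.topEquiv.symm,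
    fun τ => ?_⟩
  exact hΦ _ τ rfl

theorem relMap_equiv {M N : Type u} [wordTemplate.{u}.L.Structure M]
    [wordTemplate.{u}.L.Structure N] (Φ : M ≃[wordTemplate.{u}.L] N) {n : ℕ} (r : TauRel n)
    (x : Fin n → M) :
    Language.Structure.RelMap (L := wordTemplate.{u}.L) r (fun i => Φ (x i)) ↔
      Language.Structure.RelMap (L := wordTemplate.{u}.L) r x :=
  Φ.map_rel r x

theorem emLT_equiv {M N : Type u} [wordTemplate.{u}.L.Structure M]
    [wordTemplate.{u}.L.Structure N] (Φ : M ≃[wordTemplate.{u}.L] N) (x y : M) :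
    emLT wordTemplate.{u} (Φ x) (Φ y) ↔ emLT wordTemplate.{u} x y := by
  refine Iff.trans ?_ (relMap_equiv Φ TauRel.lt ![x, y])
  have : (fun i => Φ (![x, y] i)) = ![Φ x, Φ y] := by
    funext i
    fin_cases i <;> rfl
  rw [this]
  exact Iff.rfl

theorem emP_equiv {M N : Type u} [wordTemplate.{u}.L.Structure M]
    [wordTemplate.{u}.L.Structure N] (Φ : M ≃[wordTemplate.{u}.L] N) (r : TauRel 1) (x : M) :
    Language.Structure.RelMap (L := wordTemplate.{u}.L) r ![Φ x] ↔
      Language.Structure.RelMap (L := wordTemplate.{u}.L) r ![x] := by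
  refine Iff.trans ?_ (relMap_equiv Φ r ![x])
  have : (fun i => Φ (![x] i)) = ![Φ x] := by
    funext i
    fin_cases i
    rfl
  rw [this]

/-- Up to isomorphism the model is `Word J`, where the order axioms are those of signed words. The
predicates follow the first letter, and the empty word is put into `P₀`. -/
theorem isUpsilonLin2_wordTemplate : IsUpsilonLin2.{u} wordTemplate.{u} where
  countable := by
    have h₁ : ∀ n, Countable (WordFun n) := fun n => by
      have : Subsingleton (WordFun n) := ⟨by rintro ⟨⟩ ⟨⟩ <;> rfl⟩
      infer_instance
    have h₂ : ∀ n, Countable (TauRel n) := fun n => by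
      let f : TauRel n → ℕ := fun r => match r with
        | TauRel.lt => 0
        | TauRel.P0 => 1
        | TauRel.P1 => 2
      refine Function.Injective.countable (f := f) ?_
      rintro ⟨⟩ ⟨⟩ h <;> first | rfl | exact absurd h (by decide)
    have : Countable ((Σ n, WordFun n) ⊕ (Σ n, TauRel n)) := inferInstance
    exact mk_le_aleph0 (α := (Σ n, WordFun n) ⊕ (Σ n, TauRel n))
  emb_injective :=
    { onFunction := fun {n} f => Empty.elim f
      onRelation := fun {n} _ _ h => h }
  proper := fun J _ _ => ⟨Word J, inferInstance, Word.of, isEM_word J⟩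
  klin := by
    intro J _ hJ M _ a ha
    obtain ⟨Φ, hΦ⟩ := exists_equiv_word ha
    have hΦ' : ∀ t, Φ (a t) = Word.of t := fun t => hΦ (Language.Term.var t)
    have hlt : ∀ x y : M, emLT wordTemplate.{u} x y ↔ wordLT tauLT (Φ x) (Φ y) :=
      fun x y => (emLT_equiv Φ x y).symm
    have h0 : ∀ x : M, @tauP0 M (wordTemplate.{u}.emb.reduct M) x ↔ (Φ x).headIn tauP0 True :=
      fun x => (emP_equiv Φ TauRel.P0 x).symm
    have h1 : ∀ x : M, @tauP1 M (wordTemplate.{u}.emb.reduct M) x ↔ (Φ x).headIn tauP1 False :=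
      fun x => (emP_equiv Φ TauRel.P1 x).symm
    refine ⟨@IsKlin.mk M (wordTemplate.{u}.emb.reduct M) ?_ ?_ ?_ ?_ ?_, ?_, ?_, ?_⟩
    · exact fun x h => wordLT_irrefl hJ.irrefl _ ((hlt _ _).1 h)
    · exact fun x y z h h' => (hlt _ _).2
        (wordLT_trans hJ.trans _ _ _ ((hlt _ _).1 h) ((hlt _ _).1 h'))
    · intro x y
      rcases wordLT_total hJ.total (Φ x) (Φ y) with h | h | h
      · exact Or.inl ((hlt _ _).2 h)
      · exact Or.inr (Or.inl (Φ.injective h))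
      · exact Or.inr (Or.inr ((hlt _ _).2 h))
    · intro x
      rw [h0, h1]
      induction Φ x using Word.ind with
      | nil => exact Or.inl trivial
      | cons a w => exact hJ.cover a.2
    · intro x
      rw [h0, h1]
      induction Φ x using Word.ind with
      | nil => exact fun h => h.2
      | cons a w => exact hJ.disjoint a.2
    · intro s t h
      rw [hlt, hΦ', hΦ']
      exact Or.inl h
    · intro t h
      rw [h0, hΦ']
      exact h
    · intro t h
      rw [h1, hΦ']
      exact h

/-! ### Automorphisms of the order of the model over an ordinal -/

theorem extendsToAut_wordTemplate {J : Type u} [tau.Structure J] [LinearOrder J] [WellFoundedLT J]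
    [Nonempty J] [NoMaxOrder J] (hlt : ∀ x y : J, tauLT x y ↔ x < y)
    (hJ : ∀ b : J, Nonempty (Set.Ici b ≃o J)) {μ : Cardinal.{u}}
    (hb : ∀ T : Set J, #T ≤ μ → ∃ b, ∀ x ∈ T, x < b) : ExtendsToAut wordTemplate.{u} J μ := by
  intro M _ a ha S₁ S₂ h₁ h₂ h
  have hlt' : tauLT = ((· < ·) : J → J → Prop) := funext₂ fun x y => propext (hlt x y)
  let p : S₁ → J := Subtype.val
  let q : S₁ → J := fun k => h k
  have hpq : ∀ k k', p k < p k' ↔ q k < q k' := by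
    intro k k'
    rw [← hlt, ← hlt]
    have h₃ := h.map_rel (show tau.Relations 2 from TauRel.lt) ![k, k']
    have h₄ : (fun i => ((h ∘ ![k, k']) i : J)) = ![q k, q k'] := by
      funext i
      fin_cases i <;> rfl
    have h₅ : (fun i => (![k, k'] i : J)) = ![p k, p k'] := by
      funext i
      fin_cases i <;> rfl
    change Language.Structure.RelMap (L := tau) TauRel.lt (fun i => ((h ∘ ![k, k']) i : J)) ↔
      Language.Structure.RelMap (L := tau) TauRel.lt (fun i => (![k, k'] i : J)) at h₃
    rw [h₄, h₅] at h₃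
    exact h₃.symm
  obtain ⟨b₁, hb₁⟩ := hb (S₁ : Set J) h₁
  obtain ⟨b₂, hb₂⟩ := hb (S₂ : Set J) h₂
  obtain ⟨G, hG⟩ := exists_orderIso_map hJ (p := p) (q := q) (b := max b₁ b₂)
    (fun k => (hb₁ _ k.2).trans_le (le_max_left _ _))
    (fun k => (hb₂ _ (h k).2).trans_le (le_max_right _ _))
    (fun k k' => by rw [← not_lt, ← not_lt, hpq])
  have hqf : ∀ (n : ℕ) (t : Fin n → S₁), qfType wordTemplate.{u}.L (fun i => a (p (t i))) =
      qfType wordTemplate.{u}.L (fun i => a (q (t i))) := by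
    intro n t
    refine (ha.qfType_eq n fun i => p (t i)).trans
      (Eq.trans ?_ (ha.qfType_eq n fun i => q (t i)).symm)
    congr 1
    -- `h` and both inclusions preserve quantifier-free types in `J`, and the template sees nothing
    -- else.
    exact (qfType_embedding S₁.subtype t).trans ((qfType_embedding h.toEmbedding t).symm.trans
      (qfType_embedding S₂.subtype fun i => h (t i)).symm)
  have hA : ∀ x, x ∈ emSub wordTemplate.{u} a S₁ ↔
      ∃ τ : wordTemplate.{u}.L.Term S₁, τ.realize (fun k => a (p k)) = x := by
    intro x
    rw [← mem_closure_range_iff, emSub]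
    have : a '' (S₁ : Set J) = Set.range (fun k => a (p k)) := by
      rw [Set.image_eq_range]
      rfl
    rw [this]
  have hB : ∀ x, x ∈ emSub wordTemplate.{u} a S₂ ↔
      ∃ τ : wordTemplate.{u}.L.Term S₁, τ.realize (fun k => a (q k)) = x := by
    intro x
    rw [← mem_closure_range_iff, emSub]
    have : a '' (S₂ : Set J) = Set.range (fun k => a (q k)) := by
      ext y
      constructor
      · rintro ⟨t, ht, rfl⟩
        obtain ⟨k, hk⟩ := h.surjective ⟨t, ht⟩
        exact ⟨k, by simp only [q, hk]⟩
      · rintro ⟨k, rfl⟩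
        exact ⟨q k, (h k).2, rfl⟩
    rw [this]
  obtain ⟨Ψ, hΨ⟩ := exists_equiv_of_qfType_eq hqf hA hB
  obtain ⟨Φ, hΦ⟩ := exists_equiv_word ha
  -- The automorphism is `G` conjugated by the isomorphism `Φ` of the given model with `Word J`.
  refine ⟨Ψ, fun t => hΨ _ (Language.Term.var t) rfl,
    (Φ.toEquiv.trans G.toEquiv).trans Φ.toEquiv.symm, fun x y => ?_, fun x => ?_⟩
  · rw [← emLT_equiv Φ x y, ← emLT_equiv Φ]
    have hΦs : ∀ z, Φ (((Φ.toEquiv.trans G.toEquiv).trans Φ.toEquiv.symm) z) = G (Φ z) :=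
      fun z => Φ.toEquiv.apply_symm_apply _
    rw [hΦs, hΦs]
    change wordLT tauLT (Φ x) (Φ y) ↔ wordLT tauLT (G (Φ x)) (G (Φ y))
    rw [hlt']
    exact (G.lt_iff_lt (x := Φ x) (y := Φ y)).symm
  · obtain ⟨τ, hτ⟩ := (hA x).1 x.2
    rw [hΨ x τ hτ]
    have hrel : ∀ r : S₁ → J, Φ (τ.realize fun k => a (r k)) = (wordEval τ).map r := by
      intro r
      have := hΦ (τ.relabel r)
      rw [Language.Term.realize_relabel, Language.Term.realize_relabel] at this
      exact this.trans (realize_word r τ)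
    apply Φ.injective
    refine (Φ.toEquiv.apply_symm_apply _).trans ?_
    change G (Φ x) = _
    rw [← hτ, hrel, hrel]
    exact hG _

/-! ### Additively indecomposable ordinals of large cofinality -/

theorem exists_bound {ζ : Ordinal.{u}} {T : Set ζ.ToType} (hT : #T < ζ.cof) :
    ∃ b, ∀ x ∈ T, x < b := by
  by_contra! h
  have hcof : Order.cof ζ.ToType = ζ.cof := by
    rw [← Ordinal.cof_type, Ordinal.type_toType]
  exact ((Order.cof_le h).trans_lt (hT.trans_eq hcof.symm)).false

theorem nonempty_Ici_orderIso {J : Type u} [LinearOrder J] [WellFoundedLT J]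
    (h : Ordinal.IsPrincipal (· + ·) (Ordinal.type (α := J) (· < ·))) (b : J) :
    Nonempty (Set.Ici b ≃o J) := by
  have hsum : Ordinal.type (α := Set.Iio b) (· < ·) + Ordinal.type (α := Set.Ici b) (· < ·) =
      Ordinal.type (α := J) (· < ·) := by
    rw [← Ordinal.type_sum_lex]
    exact Ordinal.type_eq.2 ⟨(OrderIso.sumLexIioIci b).toRelIsoLT⟩
  have h₁ : Ordinal.type (α := Set.Iio b) (· < ·) < Ordinal.type (α := J) (· < ·) :=
    Ordinal.typein_lt_type (· < ·) b
  have h₂ : Ordinal.type (α := Set.Ici b) (· < ·) = Ordinal.type (α := J) (· < ·) := by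
    -- Were the final segment shorter than `J`, its sum with the proper initial segment below `b`
    -- would be shorter too, by indecomposability.
    refine (Ordinal.type_le_iff'.2 ⟨(OrderEmbedding.subtype _).ltEmbedding⟩).antisymm
      (not_lt.1 fun hlt => (h h₁ hlt).ne hsum)
  exact (Ordinal.type_eq.1 h₂).map OrderIso.ofRelIsoLT

theorem isPrincipal_add_mul_ord (lam : Cardinal.{u}) {θ : Cardinal.{u}} (hθ : θ.IsRegular) :
    Ordinal.IsPrincipal (· + ·) (lam.ord * θ.ord) := by
  refine Ordinal.isPrincipal_add_mul_of_isPrincipal_add _ ?_ (Ordinal.isPrincipal_add_ord hθ.aleph0_le)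
  rw [Ne, ord_eq_one]
  exact (one_lt_aleph0.trans_le hθ.aleph0_le).ne'

theorem cof_mul_ord {lam θ : Cardinal.{u}} (hlam : lam ≠ 0) (hθ : θ.IsRegular) :
    (lam.ord * θ.ord).cof = θ := by
  rw [Ordinal.cof_mul (by simpa using hlam) (isSuccLimit_ord hθ.aleph0_le).isSuccPrelimit,
    hθ.cof_ord]

noncomputable instance (κ : Cardinal.{u}) (ζ : Ordinal.{u}) : LinearOrder (Ilin κ ζ) :=
  inferInstanceAs (LinearOrder ζ.ToType)

instance (κ : Cardinal.{u}) (ζ : Ordinal.{u}) : WellFoundedLT (Ilin κ ζ) :=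
  inferInstanceAs (WellFoundedLT ζ.ToType)

theorem Ilin.tauLT_iff {κ : Cardinal.{u}} {ζ : Ordinal.{u}} (x y : Ilin κ ζ) :
    tauLT x y ↔ x < y :=
  OrderIso.lt_iff_lt (Ordinal.ToType.mk (o := ζ)).symm (x := x) (y := y)

end HomLin

/-! ### Assembly of the theorem -/

theorem mainTheorem10 (μ θ₁ θ₂ lam : Cardinal.{u}) (hμ : ℵ₀ ≤ μ) (hθ₁ : θ₁ = Order.succ μ)
    (hθ₁₂ : θ₁ < θ₂) (hθ₂ : θ₂.IsRegular) (hlam : θ₂ < lam) :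
    ∃ (I : Type u) (_ : LinearOrder I),
      #I = lam ∧
      -- (1)
      #(Quotient (HomLin.autSetoid (∅ : Set I) μ.ord.ToType)) ≤ 2 ^ μ ∧
      -- (2)
      (∀ (A : Set I), #A < θ₂ → ∀ n : ℕ,
        #(Quotient (HomLin.autSetoid A (Fin n))) ≤ μ + #A) ∧
      -- (4)
      (∀ (A : Set I), #A < θ₂ → ∃ B : Set I, #B ≤ θ₁ + #A ∧
        ∀ J : Set I, #J ≤ μ → ∃ h : I ≃o I, (∀ x ∈ A, h x = x) ∧ ∀ x ∈ J, h x ∈ B) ∧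
      -- (3) and (5)
      ∃ Ψ : HomLin.Template, HomLin.IsUpsilonLin2.{u} Ψ ∧
        (∀ κ : Cardinal.{u}, κ = θ₁ ∨ κ = θ₂ →
          HomLin.IsEMlt Ψ (HomLin.Ilin κ (lam.ord * θ₂.ord)) I) ∧
        (∀ κ θ : Cardinal.{u}, κ = μ ∨ κ = θ₁ ∨ κ = θ₂ → θ = θ₁ ∨ θ = θ₂ →
          HomLin.ExtendsToAut Ψ (HomLin.Ilin κ (lam.ord * θ.ord)) μ) := by
  subst hθ₁
  have hμ₁ : μ < Order.succ μ := Order.lt_succ μ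
  have hμ₂ : μ < θ₂ := hμ₁.trans hθ₁₂
  have hlam₀ : ℵ₀ ≤ lam := hμ.trans (hμ₂.trans hlam).le
  have hlam₁ : lam ≠ 0 := (aleph0_pos.trans_le hlam₀).ne'
  have hbound : ∀ {θ : Cardinal.{u}}, θ.IsRegular → ∀ T : Set (lam.ord * θ.ord).ToType,
      #T < θ → ∃ b, ∀ x ∈ T, x < b := fun hθ T hT =>
    HomLin.exists_bound (hT.trans_eq (HomLin.cof_mul_ord hlam₁ hθ).symm)
  have hnonempty : ∀ {θ : Cardinal.{u}}, θ.IsRegular → Nonempty (lam.ord * θ.ord).ToType :=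
    fun hθ => (hbound hθ ∅ (by simpa using hθ.pos)).nonempty
  have hnomax : ∀ {θ : Cardinal.{u}}, θ.IsRegular → NoMaxOrder (lam.ord * θ.ord).ToType :=
    fun hθ => ⟨fun x => (hbound hθ {x} (by
      rw [mk_singleton]
      exact one_lt_aleph0.trans_le hθ.aleph0_le)).imp fun b hb => hb x rfl⟩
  have hIci : ∀ {θ : Cardinal.{u}}, θ.IsRegular → ∀ b : (lam.ord * θ.ord).ToType,
      Nonempty (Set.Ici b ≃o (lam.ord * θ.ord).ToType) := fun hθ =>
    HomLin.nonempty_Ici_orderIso (by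
      rw [Ordinal.type_toType]
      exact HomLin.isPrincipal_add_mul_ord lam hθ)
  have := hnonempty hθ₂
  have := hnomax hθ₂
  have hιμ : #μ.ord.ToType = μ := mk_ord_toType μ
  refine ⟨HomLin.Word (lam.ord * θ₂.ord).ToType, inferInstance, ?_, ?_, ?_, ?_,
    HomLin.wordTemplate.{u}, HomLin.isUpsilonLin2_wordTemplate, ?_, ?_⟩
  · have hJ : #(lam.ord * θ₂.ord).ToType = lam := by
      rw [mk_toType, Ordinal.card_mul, card_ord, card_ord, mul_eq_left hlam₀ hlam.le hθ₂.pos.ne']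
    refine le_antisymm (HomLin.mk_word_le hlam₀ hJ.le) ?_
    conv_lhs => rw [← hJ]
    exact mk_le_of_injective (HomLin.isEM_word (HomLin.Ilin μ (lam.ord * θ₂.ord))).injective
  · conv_rhs => rw [← hιμ]
    refine HomLin.mk_quotient_autSetoid_empty (hIci hθ₂) (hμ.trans_eq hιμ.symm) fun T hT => ?_
    exact hbound hθ₂ T ((hT.trans_eq hιμ).trans_lt hμ₂)
  · intro A hA n
    refine (HomLin.mk_quotient_autSetoid_fin (hIci hθ₂) (hμ.trans_lt hμ₂) (hbound hθ₂) A hA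
      n).trans ?_
    exact max_le (hμ.trans (self_le_add_right _ _)) (self_le_add_left _ _)
  · intro A hA
    exact HomLin.exists_absorbing_set (hIci hθ₂) hμ hμ₂ (hbound hθ₂) A hA
  · intro κ _
    -- `κ` affects only `P₀` and `P₁`, so the identity map is the required isomorphism of orders.
    refine ⟨HomLin.Word (HomLin.Ilin κ (lam.ord * θ₂.ord)), inferInstance, HomLin.Word.of,
      HomLin.isEM_word _, Equiv.refl _, fun x y => ?_⟩
    have : HomLin.tauLT (M := HomLin.Ilin κ (lam.ord * θ₂.ord)) =
        ((· < ·) : (lam.ord * θ₂.ord).ToType → (lam.ord * θ₂.ord).ToType → Prop) :=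
      funext₂ fun x y => propext (HomLin.Ilin.tauLT_iff x y)
    change _ ↔ HomLin.wordLT (HomLin.tauLT (M := HomLin.Ilin κ (lam.ord * θ₂.ord))) x y
    rw [this]
    exact Iff.rfl
  · intro κ θ _ hθ
    have hθr : θ.IsRegular := by
      rcases hθ with rfl | rfl
      exacts [isRegular_succ hμ, hθ₂]
    have hμθ : μ < θ := by
      rcases hθ with rfl | rfl
      exacts [hμ₁, hμ₂]
    have : Nonempty (HomLin.Ilin κ (lam.ord * θ.ord)) := hnonempty hθr
    have : NoMaxOrder (HomLin.Ilin κ (lam.ord * θ.ord)) := hnomax hθr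
    exact HomLin.extendsToAut_wordTemplate HomLin.Ilin.tauLT_iff (hIci hθr)
      fun T hT => hbound hθr T (hT.trans_lt hμθ)
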